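/- Consider one-parameter families of near-integrable two-degrees-of-freedom Hamiltonians $$H(x,v,D,\theta;c,\varepsilon)=H_0(x,v,D;c)+\varepsilon H_1(x,v,D,\theta;\varepsilon),\qquad (x,v,D)\in\mathbb R^3,\ \theta\in\mathbb T=\mathbb R/2\pi\mathbb Z,\ c,\varepsilon\in\mathbb R,$$ with $H_0,H_1$ of class $C^\infty$ and equations of motion $\dot x=\partial_vH$, $\dot v=-\partial_xH$, $\dot\theta=\partial_DH$, $\dot D=-\partial_\theta H$. The spaces of such pairs $(H_0,H_1)$, and of single integrable Hamiltonians $h\in C^\infty(\mathbb R^3)$, carry the $C^\infty$ topology of uniform convergence of all derivatives on compact sets. A set is called generic if it is residual (contains a countable intersection of dense open sets) and dense. An integrable Hamiltonian $h(x,v,D)$ has a *circle of parabolic fixed points* at $q\in\mathbb R^3$ if all points of $\{q\}\times\mathbb T$ are fixed points of its flow and $\det\frac{\partial^2h}{\partial(x,v)^2}(q)=0$. The family has a *parabolic resonance* at $z=(q,c)$ if $H_0(\cdot;c)$ has a circle of parabolic fixed points at $q$ and this circle is perturbed, i.e. $\frac{\partial}{\partial\varepsilon}\dot D|_{\varepsilon=0}=-\partial_\theta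 H_1(q,\theta;0)$ does not vanish for all $\theta$. It is *transverse* if at $z$ the differentials (in $(x,v,D,c)$) of $\partial_xH_0$, $\partial_vH_0$, $\det\frac{\partial^2H_0}{\partial(x,v)^2}$, $\partial_DH_0$ are linearly independent, i.e. the curve of parabolic points of the $(x,v)$-flow crosses the hypersurface $\{\partial_DH_0=0\}$ transversally. Then the occurrence of a parabolic resonance is generic in one-parameter families, and of codimension one, in the following sense. 1. The set of families having a transverse parabolic resonance is open and dense. Moreover, for each non-empty open $V\subseteq\mathbb R^3\times\mathbb R$, the set of families having a transverse parabolic resonance at some point of $V$ is open and non-empty. 2. For a generic family $(H_0,H_1)$, each circle of parabolic fixed points of the unperturbed system is a transverse parabolic resonance, and only finitely many of them lie in each compact subset of $(x,v,D,c)$-space. 3. Each transverse parabolic resonance is isolated and persists: if $(H_0,H_1)$ has one at $z$, then each neighbourhood of $z$ contains a neighbourhood $W$ of $z$ such that every family sufficiently close to $(H_0,H_1)$ has exactly one circle of parabolic fixed points in $W$, and this one is a transverse parabolic resonance. 4. A generic single integrable Hamiltonian $h(x,v,D)$ (no parameter) has no circle of parabolic fixed points. -/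

import Mathlib

open Topology Real
open scoped ContDiff

noncomputable section

namespace ParabolicResonance

/-- The space `C^∞(E, ℝ)` of smooth real functions on a normed space. -/
structure SmoothFn (E : Type) [NormedAddCommGroup E] [NormedSpace ℝ E] where
  toFun : E → ℝ
  smooth : ContDiff ℝ ∞ toFun

instance (E : Type) [NormedAddCommGroup E] [NormedSpace ℝ E] :
    CoeFun (SmoothFn E) (fun _ => E → ℝ) := ⟨SmoothFn.toFun⟩

/-- The `k`-th derivative of a smooth function, as a continuous map. -/
def SmoothFn.jet {E : Type} [NormedAddCommGroup E] [NormedSpace ℝ E]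
    (f : SmoothFn E) (k : ℕ) : C(E, E [×k]→L[ℝ] ℝ) :=
  ⟨iteratedFDeriv ℝ k f.toFun,
    f.smooth.continuous_iteratedFDeriv (by exact_mod_cast le_top)⟩

/-- The `C^∞` topology: a net converges iff every derivative converges uniformly on
compact sets. -/
instance (E : Type) [NormedAddCommGroup E] [NormedSpace ℝ E] : TopologicalSpace (SmoothFn E) :=
  TopologicalSpace.induced (fun f (k : ℕ) => f.jet k) inferInstance

/-- The reduced space, with coordinates `0 = x`, `1 = v`, `2 = D`. -/
abbrev Q : Type := Fin 3 → ℝ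

/-- The phase space of points `((x, v, D), θ)`; the angle `θ` is represented by a real number,
and functions of `θ` are `2π`-periodic. -/
abbrev Phase : Type := Q × ℝ

/-- A perturbing term `H₁(x, v, D, θ; ε)`, a smooth function which is `2π`-periodic in `θ`. The
argument is `((x, v, D), θ, ε)`. -/
structure Perturbation extends SmoothFn (Q × ℝ × ℝ) where
  periodic : ∀ (q : Q) (ε : ℝ), Function.Periodic (fun θ => toFun (q, θ, ε)) (2 * π)

/-- The `C^∞` topology on the perturbing terms. -/
instance : TopologicalSpace Perturbation :=
  TopologicalSpace.induced Perturbation.toSmoothFn inferInstance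

/-- A one-parameter family of near-integrable two-degrees-of-freedom Hamiltonians
`H₀(x, v, D; c) + ε H₁(x, v, D, θ; ε)`, given by the pair `(H₀, H₁)`, with the product of the
`C^∞` topologies. The argument of `H₀` is `((x, v, D), c)`. -/
abbrev Family : Type := SmoothFn (Q × ℝ) × Perturbation

/-- The unperturbed Hamiltonian `H₀(·; c)`. -/
def Family.unperturbed (K : Family) (c : ℝ) : Q → ℝ := fun q => K.1 (q, c)

/-- The full Hamiltonian at the parameter values `c` and `ε`. -/
def Family.ham (K : Family) (c ε : ℝ) : Phase → ℝ :=
  fun p => K.unperturbed c p.1 + ε * K.2.toFun (p.1, p.2, ε)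

/-- The Hamiltonian vector field of `H`:
`x' = ∂H/∂v`, `v' = -∂H/∂x`, `D' = -∂H/∂θ`, `θ' = ∂H/∂D`. -/
def hamVF (H : Phase → ℝ) (p : Phase) : Phase :=
  (![fderiv ℝ H p (Pi.single 1 1, 0),
     -fderiv ℝ H p (Pi.single 0 1, 0),
     -fderiv ℝ H p (0, 1)],
   fderiv ℝ H p (Pi.single 2 1, 0))

/-- The circle `{q} × 𝕋` consists of fixed points of the Hamiltonian flow of `H`. -/
def IsCircleOfFixedPoints (H : Phase → ℝ) (q : Q) : Prop :=
  ∀ θ : ℝ, hamVF H (q, θ) = 0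

/-- The partial derivative of `h(x, v, D)` in the `i`-th coordinate. -/
def pderiv (i : Fin 3) (h : Q → ℝ) (q : Q) : ℝ := fderiv ℝ h q (Pi.single i 1)

/-- The determinant of the Hessian of `h(x, v, D)` in the two variables `(x, v)`. -/
def detHess (h : Q → ℝ) (q : Q) : ℝ :=
  (Matrix.of fun i j : Fin 2 => pderiv j.castSucc (pderiv i.castSucc h) q).det

/-- For the integrable Hamiltonian `h(x, v, D)`, the circle `{q} × 𝕋` is a circle of parabolic
fixed points. -/
def IsParabolicCircle (h : Q → ℝ) (q : Q) : Prop :=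
  IsCircleOfFixedPoints (fun p => h p.1) q ∧ detHess h q = 0

/-- The unperturbed system of the family has a circle of parabolic fixed points at
`z = ((x, v, D), c)`. -/
def Family.HasParabolicCircle (K : Family) (z : Q × ℝ) : Prop :=
  IsParabolicCircle (K.unperturbed z.2) z.1

/-- The family has a parabolic resonance at `z = ((x, v, D), c)`: the unperturbed system has a
circle of parabolic fixed points there, and the circle is perturbed, i.e. along it `D'` is
not identically zero to first order in `ε`. -/
def Family.HasParabolicResonance (K : Family) (z : Q × ℝ) : Prop :=
  K.HasParabolicCircle z ∧
    ∃ θ : ℝ, deriv (fun ε : ℝ => (hamVF (K.ham z.2 ε) (z.1, θ)).1 2) 0 ≠ 0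

/-- In the space of `(x, v, D, c)`, the set `P` of parabolic fixed points of the `(x, v)`-plane
is given by `∂H₀/∂x = 0`, `∂H₀/∂v = 0`, `det = 0`, and the set `T` of zero angular velocity by
`∂H₀/∂D = 0`. At a common point `z`, the set `P` is (infinitesimally) a smooth curve, `T` is a
smooth hypersurface, and the curve crosses the hypersurface transversally, iff the four
differentials are linearly independent. -/
def Family.IsTransverseAt (K : Family) (z : Q × ℝ) : Prop :=
  LinearIndependent ℝ
    ![fderiv ℝ (fun w : Q × ℝ => pderiv 0 (K.unperturbed w.2) w.1) z,
      fderiv ℝ (fun w : Q × ℝ => pderiv 1 (K.unperturbed w.2) w.1) z,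
      fderiv ℝ (fun w : Q × ℝ => detHess (K.unperturbed w.2) w.1) z,
      fderiv ℝ (fun w : Q × ℝ => pderiv 2 (K.unperturbed w.2) w.1) z]

/-- A parabolic resonance at a transverse intersection of `P` and `T`. -/
def Family.HasTransverseResonance (K : Family) (z : Q × ℝ) : Prop :=
  K.HasParabolicResonance z ∧ K.IsTransverseAt z

/-- A set is generic if it is residual (contains a countable intersection of dense open sets)
and dense. -/
def IsGeneric {X : Type} [TopologicalSpace X] (S : Set X) : Prop :=
  S ∈ residual X ∧ Dense S

end ParabolicResonance

end

open ParabolicResonance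

noncomputable section

namespace ParabolicResonance

/-! ### The `C^∞` topology: continuity of derivatives, evaluation and linear operations. -/

section SmoothFn

variable {E : Type} [NormedAddCommGroup E] [NormedSpace ℝ E]

/-! Parabolic circles of `H₀` are the zeros of `F = (∂ₓH₀, ∂ᵥH₀, det, ∂_D H₀) : ℝ⁴ → ℝ⁴`, and
transversality at a zero says that the derivative of `F` there is injective, hence invertible.
Everything is about nondegenerate zeros of `F`, which with its derivative depends continuously on
`H₀` and the point jointly. A quantitative inverse function theorem (`nondegenerate_zero_persists`)
then gives isolation, persistence and openness.

Genericity needs density of the families all of whose parabolic circles are nondegenerate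
(`dense_nondegenerate`). Add to `H₀` a polynomial with six coefficients: the linear ones in `x, v,
D` and the quadratic ones in `x, v`. Singular symmetric `2 × 2` matrices form a cone with a singular
vertex, so it is parametrised by `σ u uᵀ`, `σ = ±1`, `u ∈ ℝ²`. A point `z ∈ ℝ⁴` and a vector `u`
determine the unique polynomial that puts a parabolic circle with Hessian `σ u uᵀ` at `z`; this is a
map `ℝ⁶ → ℝ⁶`. Degenerate circles occur only at its critical values, which are null by the
equidimensional Sard theorem. The circles that remain are countably many, so adding `t sin θ` to
`H₁` for suitable small `t` perturbs all of them (`dense_transverse_perturb`). Exhaustion by compact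
balls makes the good set a `Gδ`.

For occurrence, a model with a nondegenerate circle is implanted far away, where the topology exerts
no control, or at a prescribed point. A single Hamiltonian is a family constant in `c`: the
`c`-direction lies in the kernel of the derivative of `F`, so nondegeneracy of all zeros means there
are none. -/

theorem SmoothFn.ext {f g : SmoothFn E} (h : ∀ z, f z = g z) : f = g := by
  cases f; cases g
  congr
  exact funext h

/-- The directional derivative of a smooth function. -/
def SmoothFn.dir (v : E) (f : SmoothFn E) : SmoothFn E where
  toFun x := fderiv ℝ f.toFun x v
  smooth := (f.smooth.fderiv_right (m := ∞) (by simp)).clm_apply contDiff_const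

theorem SmoothFn.differentiable (f : SmoothFn E) : Differentiable ℝ f.toFun :=
  f.smooth.differentiable (by simp)

theorem SmoothFn.hasFDerivAt (f : SmoothFn E) (z : E) :
    HasFDerivAt f.toFun (fderiv ℝ f.toFun z) z :=
  (f.differentiable z).hasFDerivAt

theorem SmoothFn.continuous_jet (k : ℕ) : Continuous (fun f : SmoothFn E => f.jet k) :=
  (continuous_apply (A := fun k : ℕ => C(E, E [×k]→L[ℝ] ℝ)) k).comp
    (continuous_induced_dom (f := fun (f : SmoothFn E) (k : ℕ) => f.jet k))

theorem SmoothFn.continuous_iff_jet {X : Type*} [TopologicalSpace X] {g : X → SmoothFn E} :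
    Continuous g ↔ ∀ k, Continuous fun x => (g x).jet k :=
  continuous_induced_rng.trans continuous_pi_iff

/-- The `k`-jet of `f.dir v` is the `(k + 1)`-jet of `f` followed by a fixed continuous linear map,
namely inserting `v` in the last slot. -/
theorem SmoothFn.continuous_dir (v : E) : Continuous (SmoothFn.dir v) := by
  refine SmoothFn.continuous_iff_jet.2 fun k => ?_
  let L : (E [×(k + 1)]→L[ℝ] ℝ) →L[ℝ] (E [×k]→L[ℝ] ℝ) :=
    (ContinuousLinearMap.compContinuousMultilinearMapL ℝ (fun _ : Fin k => E) (E →L[ℝ] ℝ) ℝ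
      (ContinuousLinearMap.apply ℝ ℝ v)).comp
      ((continuousMultilinearCurryRightEquiv' ℝ k E ℝ).toContinuousLinearEquiv :
        (E [×(k + 1)]→L[ℝ] ℝ) →L[ℝ] (E [×k]→L[ℝ] (E →L[ℝ] ℝ)))
  have key : ∀ f : SmoothFn E, (f.dir v).jet k =
      (⟨L, L.continuous⟩ : C(_, _)).comp (f.jet (k + 1)) := by
    intro f
    ext z m
    have h1 : ContDiff ℝ ∞ (fderiv ℝ f.toFun) := f.smooth.fderiv_right (m := ∞) (by simp)
    have h2 := (ContinuousLinearMap.apply ℝ ℝ v).iteratedFDeriv_comp_left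
      (h1.contDiffAt (x := z)) (i := k) (by exact_mod_cast le_top)
    have h3 := iteratedFDeriv_succ_apply_right (𝕜 := ℝ) (f := f.toFun) (x := z)
      (n := k) (Fin.snoc m v)
    change iteratedFDeriv ℝ k (fun x => fderiv ℝ f.toFun x v) z m = L (iteratedFDeriv ℝ (k + 1) f.toFun z) m
    have h4 : iteratedFDeriv ℝ k (fun x => fderiv ℝ f.toFun x v) z m =
      iteratedFDeriv ℝ k (fun y => fderiv ℝ f.toFun y) z m v := by
      have := congrArg (fun T => T m) h2
      exact this
    rw [h4]
    simp at h3
    rw [← h3]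
    simp [L]
  simp_rw [key]
  exact (ContinuousMap.continuous_postcomp _).comp (SmoothFn.continuous_jet (k + 1))

/-- Only the `0`-jet matters; on a locally compact space evaluation is jointly continuous for the
compact-open topology. -/
theorem SmoothFn.continuous_eval [LocallyCompactSpace E] :
    Continuous (fun p : SmoothFn E × E => p.1 p.2) := by
  have h : Continuous fun p : SmoothFn E × E => (p.1.jet 0) p.2 :=
    ((SmoothFn.continuous_jet 0).comp continuous_fst).eval continuous_snd
  have h2 : Continuous fun p : SmoothFn E × E => (p.1.jet 0) p.2 (fun _ => 0) :=
    (ContinuousMultilinearMap.apply ℝ (fun _ : Fin 0 => E) ℝ (fun _ => 0)).continuous.comp h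
  exact h2

theorem SmoothFn.continuous_fderiv [FiniteDimensional ℝ E] :
    Continuous (fun p : SmoothFn E × E => fderiv ℝ p.1.toFun p.2) := by
  have : ProperSpace E := FiniteDimensional.proper_real E
  refine continuous_clm_apply.2 fun v => ?_
  exact SmoothFn.continuous_eval.comp
    (((SmoothFn.continuous_dir v).comp continuous_fst).prodMk continuous_snd)

instance : Add (SmoothFn E) := ⟨fun f g => ⟨fun z => f z + g z, f.smooth.add g.smooth⟩⟩

instance : SMul ℝ (SmoothFn E) := ⟨fun c f => ⟨fun z => c * f z, contDiff_const.mul f.smooth⟩⟩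

instance : ContinuousAdd (SmoothFn E) where
  continuous_add := by
    refine SmoothFn.continuous_iff_jet.2 fun k => ?_
    have : ∀ p : SmoothFn E × SmoothFn E, (p.1 + p.2).jet k = p.1.jet k + p.2.jet k := by
      intro p
      ext1 z
      exact iteratedFDeriv_add_apply (p.1.smooth.contDiffAt.of_le (by exact_mod_cast le_top))
        (p.2.smooth.contDiffAt.of_le (by exact_mod_cast le_top))
    simp_rw [this]
    exact ((SmoothFn.continuous_jet k).comp continuous_fst).add
      ((SmoothFn.continuous_jet k).comp continuous_snd)

instance : ContinuousSMul ℝ (SmoothFn E) where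
  continuous_smul := by
    refine SmoothFn.continuous_iff_jet.2 fun k => ?_
    have : ∀ p : ℝ × SmoothFn E, (p.1 • p.2).jet k = p.1 • p.2.jet k := by
      intro p
      ext1 z
      exact iteratedFDeriv_const_smul_apply (a := p.1) (p.2.smooth.contDiffAt.of_le (by exact_mod_cast le_top))
    simp_rw [this]
    exact continuous_fst.smul ((SmoothFn.continuous_jet k).comp continuous_snd)

@[simp] theorem SmoothFn.add_apply (f g : SmoothFn E) (z : E) : (f + g) z = f z + g z := rfl

@[simp] theorem SmoothFn.smul_apply (c : ℝ) (f : SmoothFn E) (z : E) : (c • f) z = c * f z := rfl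

/-- Convergence in the `C^∞` topology of functions which are eventually equal to the limit near
each point of any given compact set. -/
theorem SmoothFn.tendsto_of_eventually_eq {ι : Type*} {l : Filter ι} {g : ι → SmoothFn E}
    {f : SmoothFn E}
    (h : ∀ C : Set E, IsCompact C → ∀ᶠ n in l, ∀ z ∈ C, (g n).toFun =ᶠ[𝓝 z] f.toFun) :
    Filter.Tendsto g l (𝓝 f) := by
  rw [nhds_induced, Filter.tendsto_comap_iff, tendsto_pi_nhds]
  intro k
  rw [ContinuousMap.tendsto_iff_forall_isCompact_tendstoUniformlyOn]
  intro C hC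
  rw [Metric.tendstoUniformlyOn_iff]
  intro ε hε
  filter_upwards [h C hC] with n hn z hz
  have : iteratedFDeriv ℝ k (g n).toFun z = iteratedFDeriv ℝ k f.toFun z :=
    ((hn z hz).iteratedFDeriv ℝ k).eq_of_nhds
  change dist (iteratedFDeriv ℝ k f.toFun z) (iteratedFDeriv ℝ k (g n).toFun z) < ε
  rw [this, dist_self]
  exact hε

end SmoothFn

/-! ### Persistence of nondegenerate zeros, by a uniform inverse function theorem. -/

section Persistence

variable {E : Type} [NormedAddCommGroup E] [NormedSpace ℝ E] [FiniteDimensional ℝ E] [Nontrivial E]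

/-- A nondegenerate zero of a map depending continuously on a parameter in the `C¹` sense is
isolated and persists, with uniform neighbourhoods. -/
theorem nondegenerate_zero_persists {X : Type} [TopologicalSpace X] {n : ℕ}
    (hE : Module.finrank ℝ E = n) (F : X → E → (Fin n → ℝ)) (F' : X → E → E →L[ℝ] (Fin n → ℝ))
    (hF : ∀ x z, HasFDerivAt (F x) (F' x z) z) (hc : Continuous fun p : X × E => F p.1 p.2)
    (hc' : Continuous fun p : X × E => F' p.1 p.2) {x₀ : X} {z₀ : E} (h0 : F x₀ z₀ = 0)
    (hinj : Function.Injective (F' x₀ z₀)) {P : X → E → Prop}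
    (hP : ∀ᶠ p in 𝓝 (x₀, z₀), P p.1 p.2) :
    ∃ W ∈ 𝓝 z₀, (∀ y ∈ W, P x₀ y) ∧ ∀ᶠ x in 𝓝 x₀, ∃ z' ∈ W, F x z' = 0 ∧
      ∀ y ∈ W, P x y ∧ Function.Injective (F' x y) ∧ (F x y = 0 → y = z') := by
  have : CompleteSpace E := FiniteDimensional.complete ℝ E
  let A : E ≃L[ℝ] (Fin n → ℝ) :=
    (LinearEquiv.ofInjectiveOfFinrankEq (F' x₀ z₀ : E →ₗ[ℝ] (Fin n → ℝ)) hinj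
      (by simp [hE])).toContinuousLinearEquiv
  have hA : (A : E →L[ℝ] (Fin n → ℝ)) = F' x₀ z₀ := by
    ext1 v
    rfl
  -- A map that differs from `A` by less than `N = ‖A⁻¹‖⁻¹` in the Lipschitz sense is injective and
  -- has a quantitative image bound; `N / 2` leaves a margin for both.
  set N : NNReal := ‖(A.symm : (Fin n → ℝ) →L[ℝ] E)‖₊⁻¹ with hN
  have hNpos : 0 < N := inv_pos.2 A.nnnorm_symm_pos
  have hnear : ∀ᶠ p in 𝓝 (x₀, z₀), ‖F' p.1 p.2 - A‖ < (N / 2 : NNReal) := by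
    have h1 : Continuous fun p : X × E => ‖F' p.1 p.2 - A‖ := (hc'.sub continuous_const).norm
    refine h1.continuousAt.eventually_lt continuousAt_const ?_
    simp only [hA, sub_self, norm_zero]
    exact_mod_cast half_pos hNpos
  have hinj' : ∀ᶠ p in 𝓝 (x₀, z₀), Function.Injective (F' p.1 p.2) :=
    hc'.continuousAt (x := (x₀, z₀)) (ContinuousLinearMap.isOpen_injective.mem_nhds hinj)
  have hall := hnear.and (hinj'.and hP)
  -- A product neighbourhood yields one ball on which all bounds hold simultaneously for every
  -- nearby parameter.
  rw [nhds_prod_eq, Filter.eventually_prod_iff] at hall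
  obtain ⟨pX, hpX, pE, hpE, hall⟩ := hall
  obtain ⟨r, hr, hrE⟩ := Metric.nhds_basis_closedBall.mem_iff.1 hpE
  refine ⟨Metric.closedBall z₀ r, Metric.closedBall_mem_nhds z₀ hr,
    fun y hy => (hall hpX.self_of_nhds (hrE hy)).2.2, ?_⟩
  -- The image of the ball of radius `r` contains the ball of radius `(N - N / 2) r` about `F x z₀`;
  -- it must contain `0`.
  have hsmall : ∀ᶠ x in 𝓝 x₀, ‖F x z₀‖ < ((N : ℝ) - (N / 2 : NNReal)) * r := by
    have h1 : Continuous fun x : X => ‖F x z₀‖ :=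
      (hc.comp (Continuous.prodMk_left z₀)).norm
    refine h1.continuousAt.eventually_lt continuousAt_const ?_
    have : (0 : ℝ) < N := hNpos
    simp only [h0, norm_zero, NNReal.coe_div, NNReal.coe_ofNat]
    nlinarith
  filter_upwards [hpX, hsmall] with x hx hxs
  have happ : ApproximatesLinearOn (F x) (A : E →L[ℝ] (Fin n → ℝ)) (Metric.closedBall z₀ r)
      (N / 2) := by
    intro y hy y' hy'
    exact (convex_closedBall z₀ r).norm_image_sub_le_of_norm_hasFDerivWithin_le'
      (fun w _ => (hF x w).hasFDerivWithinAt) (fun w hw => (hall hx (hrE hw)).1.le) hy' hy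
  have hinjOn := happ.injOn (Or.inr (by rw [← hN]; exact NNReal.half_lt_self hNpos.ne'))
  have hsurj := happ.surjOn_closedBall_of_nonlinearRightInverse
    A.toNonlinearRightInverse hr.le (subset_refl _)
  obtain ⟨z', hz', hz0⟩ := hsurj (show (0 : Fin n → ℝ) ∈ _ by
    rw [Metric.mem_closedBall, dist_comm, dist_zero_right]
    have : ((A.toNonlinearRightInverse.nnnorm : ℝ))⁻¹ = N := by
      rw [hN, NNReal.coe_inv]
      rfl
    rw [this]
    exact hxs.le)
  exact ⟨z', hz', hz0, fun y hy => ⟨(hall hx (hrE hy)).2.2, (hall hx (hrE hy)).2.1,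
    fun h => hinjOn hy hz' (h.trans hz0.symm)⟩⟩

end Persistence

/-! ### The map `F`, for general directions `e` so as to serve both `(x, v, D, c)` and `(x, v, D)`.
-/

section ParabolicMap

variable {E : Type} [NormedAddCommGroup E] [NormedSpace ℝ E]

/-- The Hessian determinant of `f` in the directions `e 0`, `e 1`. -/
def detDir (e : Fin 3 → E) (f : SmoothFn E) : SmoothFn E where
  toFun z := (f.dir (e 0)).dir (e 0) z * (f.dir (e 1)).dir (e 1) z -
    (f.dir (e 0)).dir (e 1) z * (f.dir (e 1)).dir (e 0) z
  smooth := (((f.dir (e 0)).dir (e 0)).smooth.mul ((f.dir (e 1)).dir (e 1)).smooth).sub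
    (((f.dir (e 0)).dir (e 1)).smooth.mul ((f.dir (e 1)).dir (e 0)).smooth)

/-- The four functions whose common zeros are the parabolic circles. -/
def parabolicComp (e : Fin 3 → E) (f : SmoothFn E) : Fin 4 → SmoothFn E :=
  ![f.dir (e 0), f.dir (e 1), detDir e f, f.dir (e 2)]

/-- The map whose zeros are the parabolic circles. -/
def parabolicMap (e : Fin 3 → E) (f : SmoothFn E) (z : E) : Fin 4 → ℝ :=
  fun i => parabolicComp e f i z

/-- The derivative of `parabolicMap`. -/
def parabolicFDeriv (e : Fin 3 → E) (f : SmoothFn E) (z : E) : E →L[ℝ] (Fin 4 → ℝ) :=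
  ContinuousLinearMap.pi fun i => fderiv ℝ (parabolicComp e f i).toFun z

theorem hasFDerivAt_parabolicMap (e : Fin 3 → E) (f : SmoothFn E) (z : E) :
    HasFDerivAt (parabolicMap e f) (parabolicFDeriv e f z) z :=
  hasFDerivAt_pi.2 fun i => (parabolicComp e f i).hasFDerivAt z

theorem fderiv_detDir (e : Fin 3 → E) (f : SmoothFn E) (z : E) :
    fderiv ℝ (detDir e f).toFun z =
      ((f.dir (e 0)).dir (e 0) z • fderiv ℝ ((f.dir (e 1)).dir (e 1)).toFun z +
        (f.dir (e 1)).dir (e 1) z • fderiv ℝ ((f.dir (e 0)).dir (e 0)).toFun z) -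
      ((f.dir (e 0)).dir (e 1) z • fderiv ℝ ((f.dir (e 1)).dir (e 0)).toFun z +
        (f.dir (e 1)).dir (e 0) z • fderiv ℝ ((f.dir (e 0)).dir (e 1)).toFun z) :=
  (((((f.dir (e 0)).dir (e 0)).hasFDerivAt z).mul (((f.dir (e 1)).dir (e 1)).hasFDerivAt z)).sub
    ((((f.dir (e 0)).dir (e 1)).hasFDerivAt z).mul
      (((f.dir (e 1)).dir (e 0)).hasFDerivAt z))).fderiv

theorem parabolicMap_eq_zero_iff (e : Fin 3 → E) (f : SmoothFn E) (z : E) :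
    parabolicMap e f z = 0 ↔ f.dir (e 0) z = 0 ∧ f.dir (e 1) z = 0 ∧ detDir e f z = 0 ∧
      f.dir (e 2) z = 0 := by
  simp [funext_iff, Fin.forall_fin_succ, parabolicMap, parabolicComp]

theorem parabolicFDeriv_eq_zero_iff (e : Fin 3 → E) (f : SmoothFn E) (z w : E) :
    parabolicFDeriv e f z w = 0 ↔ fderiv ℝ (f.dir (e 0)).toFun z w = 0 ∧
      fderiv ℝ (f.dir (e 1)).toFun z w = 0 ∧ fderiv ℝ (detDir e f).toFun z w = 0 ∧
      fderiv ℝ (f.dir (e 2)).toFun z w = 0 := by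
  simp [funext_iff, Fin.forall_fin_succ, parabolicFDeriv, parabolicComp]

theorem SmoothFn.continuous_dir_eval [LocallyCompactSpace E] (v : E) :
    Continuous (fun p : SmoothFn E × E => p.1.dir v p.2) :=
  SmoothFn.continuous_eval.comp (((SmoothFn.continuous_dir v).comp continuous_fst).prodMk
    continuous_snd)

theorem SmoothFn.continuous_dir_dir_eval [LocallyCompactSpace E] (v w : E) :
    Continuous (fun p : SmoothFn E × E => (p.1.dir v).dir w p.2) :=
  (SmoothFn.continuous_dir_eval w).comp (((SmoothFn.continuous_dir v).comp continuous_fst).prodMk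
    continuous_snd)

theorem continuous_parabolicMap [LocallyCompactSpace E] (e : Fin 3 → E) :
    Continuous (fun p : SmoothFn E × E => parabolicMap e p.1 p.2) := by
  have h := SmoothFn.continuous_dir_eval (E := E)
  have h2 := SmoothFn.continuous_dir_dir_eval (E := E)
  refine continuous_pi fun i => ?_
  fin_cases i
  · exact h (e 0)
  · exact h (e 1)
  · exact ((h2 _ _).mul (h2 _ _)).sub ((h2 _ _).mul (h2 _ _))
  · exact h (e 2)

theorem continuous_parabolicFDeriv [FiniteDimensional ℝ E] (e : Fin 3 → E) :
    Continuous (fun p : SmoothFn E × E => parabolicFDeriv e p.1 p.2) := by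
  have : ProperSpace E := FiniteDimensional.proper_real E
  have h (v : E) : Continuous (fun p : SmoothFn E × E => fderiv ℝ (p.1.dir v).toFun p.2) :=
    SmoothFn.continuous_fderiv.comp (((SmoothFn.continuous_dir v).comp continuous_fst).prodMk
      continuous_snd)
  have h2 (v w : E) :
      Continuous (fun p : SmoothFn E × E => fderiv ℝ ((p.1.dir v).dir w).toFun p.2) :=
    (h w).comp (((SmoothFn.continuous_dir v).comp continuous_fst).prodMk continuous_snd)
  have h3 := SmoothFn.continuous_dir_dir_eval (E := E)
  refine continuous_clm_apply.2 fun v => continuous_pi fun i => ?_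
  suffices Continuous (fun p : SmoothFn E × E => fderiv ℝ (parabolicComp e p.1 i).toFun p.2) from
    this.clm_apply continuous_const
  fin_cases i
  · exact h (e 0)
  · exact h (e 1)
  · change Continuous (fun p : SmoothFn E × E => fderiv ℝ (detDir e p.1).toFun p.2)
    simp_rw [fderiv_detDir]
    exact (((h3 _ _).smul (h2 _ _)).add ((h3 _ _).smul (h2 _ _))).sub
      (((h3 _ _).smul (h2 _ _)).add ((h3 _ _).smul (h2 _ _)))
  · exact h (e 2)

theorem SmoothFn.dir_congr {f g : SmoothFn E} {z : E} (h : f.toFun =ᶠ[𝓝 z] g.toFun) (v : E) :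
    (f.dir v).toFun =ᶠ[𝓝 z] (g.dir v).toFun := by
  filter_upwards [h.fderiv (𝕜 := ℝ)] with y hy
  change fderiv ℝ f.toFun y v = fderiv ℝ g.toFun y v
  rw [hy]

theorem parabolicMap_congr {f g : SmoothFn E} {z : E} (h : f.toFun =ᶠ[𝓝 z] g.toFun)
    (e : Fin 3 → E) : parabolicMap e f =ᶠ[𝓝 z] parabolicMap e g := by
  have h2 (i j) := SmoothFn.dir_congr (SmoothFn.dir_congr h (e i)) (e j)
  filter_upwards [SmoothFn.dir_congr h (e 0), SmoothFn.dir_congr h (e 1),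
    SmoothFn.dir_congr h (e 2), h2 0 0, h2 0 1, h2 1 0, h2 1 1] with y h0 h1 h2 h00 h01 h10 h11
  ext i
  fin_cases i
  · exact h0
  · exact h1
  · change _ * _ - _ * _ = _ * _ - _ * _
    rw [h00, h01, h10, h11]
  · exact h2

theorem parabolicFDeriv_congr {f g : SmoothFn E} {z : E} (h : f.toFun =ᶠ[𝓝 z] g.toFun)
    (e : Fin 3 → E) : parabolicFDeriv e f z = parabolicFDeriv e g z := by
  rw [← (hasFDerivAt_parabolicMap e f z).fderiv, ← (hasFDerivAt_parabolicMap e g z).fderiv]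
  exact (parabolicMap_congr h e).fderiv_eq

end ParabolicMap

/-- Functionals, as many as the dimension, are linearly independent iff they separate points. -/
theorem linearIndependent_iff_injective_pi {E : Type} [NormedAddCommGroup E] [NormedSpace ℝ E]
    [FiniteDimensional ℝ E] {n : ℕ} (hE : Module.finrank ℝ E = n) (φ : Fin n → E →L[ℝ] ℝ) :
    LinearIndependent ℝ φ ↔ Function.Injective (ContinuousLinearMap.pi φ) := by
  have hfr : Module.finrank ℝ E = Module.finrank ℝ (Fin n → ℝ) := by simp [hE]
  rw [show Function.Injective (ContinuousLinearMap.pi φ) ↔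
    Function.Surjective (ContinuousLinearMap.pi φ) from
      LinearMap.injective_iff_surjective_of_finrank_eq_finrank
        (f := (ContinuousLinearMap.pi φ : E →ₗ[ℝ] (Fin n → ℝ))) hfr,
    Fintype.linearIndependent_iff]
  constructor
  · intro h
    by_contra hs
    have hlt : LinearMap.range (ContinuousLinearMap.pi φ : E →ₗ[ℝ] (Fin n → ℝ)) < ⊤ :=
      lt_top_iff_ne_top.2 fun h' => hs (LinearMap.range_eq_top.1 h')
    -- A nonzero functional killing the range is a linear relation among the `φ i`, with
    -- coefficients `ψ (Pi.single i 1)`.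
    obtain ⟨ψ, hψ, hle⟩ := Submodule.exists_le_ker_of_lt_top _ hlt
    refine hψ (LinearMap.pi_ext' fun i => ?_)
    have := h (fun i => ψ (Pi.single i 1)) ?_ i
    · ext
      simpa using this
    · ext w
      have hw : ψ (fun i => φ i w) = 0 := hle ⟨w, rfl⟩
      rw [LinearMap.pi_apply_eq_sum_univ] at hw
      simp only [sum_apply, smul_apply, smul_eq_mul, zero_apply] at hw ⊢
      rw [← hw]
      refine Finset.sum_congr rfl fun i _ => ?_
      rw [mul_comm]
      congr 2
      ext j
      simp [Pi.single_apply, eq_comm]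
  · intro h c hc i
    obtain ⟨w, hw⟩ := h (Pi.single i 1)
    have h1 := congrArg (fun L : E →L[ℝ] ℝ => L w) hc
    have h2 : ∀ j, φ j w = (Pi.single i 1 : Fin n → ℝ) j := fun j => congrFun hw j
    simpa [h2, Pi.single_apply] using h1

/-! ### Polynomial perturbations with six parameters. -/

section QuadraticPerturbation

variable {E : Type} [NormedAddCommGroup E] [NormedSpace ℝ E]

theorem SmoothFn.dir_dir_apply (f : SmoothFn E) (v w z : E) :
    (f.dir v).dir w z = fderiv ℝ (fderiv ℝ f.toFun) z w v := by
  have h1 : ContDiff ℝ ∞ (fderiv ℝ f.toFun) := f.smooth.fderiv_right (m := ∞) (by simp)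
  have h2 := ((h1.differentiable (by simp)) z).hasFDerivAt.clm_apply (hasFDerivAt_const v z)
  change fderiv ℝ (fun x => fderiv ℝ f.toFun x v) z w = _
  rw [h2.fderiv]
  simp

theorem SmoothFn.dir_comm (f : SmoothFn E) (v w : E) : (f.dir v).dir w = (f.dir w).dir v := by
  refine SmoothFn.ext fun z => ?_
  rw [SmoothFn.dir_dir_apply, SmoothFn.dir_dir_apply]
  exact (f.smooth.contDiffAt.isSymmSndFDerivAt
    (by rw [minSmoothness_of_isRCLikeNormedField]; exact ENat.LEInfty.out)) w v

/-- A product of two linear forms. -/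
def SmoothFn.mulForms (φ ψ : E →L[ℝ] ℝ) : SmoothFn E := ⟨fun z => φ z * ψ z, φ.contDiff.mul ψ.contDiff⟩

/-- A linear form. -/
def SmoothFn.ofForm (φ : E →L[ℝ] ℝ) : SmoothFn E := ⟨φ, φ.contDiff⟩

/-- The parameters of the perturbing polynomials: the linear coefficients in `x, v, D` and the
coefficients of the quadratic form in `x, v`. -/
abbrev PolyParam : Type := (Q × ℝ) × (ℝ × ℝ)

/-- The polynomial with given parameters, in terms of the coordinate forms `m`. -/
def polyPert (m : Fin 3 → E →L[ℝ] ℝ) (p : PolyParam) : SmoothFn E :=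
  p.1.1 0 • SmoothFn.ofForm (m 0) + p.1.1 1 • SmoothFn.ofForm (m 1) +
  p.1.1 2 • SmoothFn.ofForm (m 2) + (p.1.2 / 2) • SmoothFn.mulForms (m 0) (m 0) +
  p.2.1 • SmoothFn.mulForms (m 0) (m 1) + (p.2.2 / 2) • SmoothFn.mulForms (m 1) (m 1)

theorem continuous_polyPert (m : Fin 3 → E →L[ℝ] ℝ) : Continuous (polyPert m) := by
  unfold polyPert
  fun_prop

theorem polyPert_zero (m : Fin 3 → E →L[ℝ] ℝ) (f : SmoothFn E) : f + polyPert m 0 = f := by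
  refine SmoothFn.ext fun z => ?_
  simp [polyPert]

theorem hasFDerivAt_add_polyPert (m : Fin 3 → E →L[ℝ] ℝ) (p : PolyParam) (f : SmoothFn E) (z : E) :
    HasFDerivAt (f + polyPert m p).toFun (fderiv ℝ f.toFun z + (p.1.1 0 • m 0 + p.1.1 1 • m 1 +
      p.1.1 2 • m 2 + (p.1.2 / 2) • (m 0 z • m 0 + m 0 z • m 0) +
      p.2.1 • (m 0 z • m 1 + m 1 z • m 0) + (p.2.2 / 2) • (m 1 z • m 1 + m 1 z • m 1))) z := by
  have h (i) := (m i).hasFDerivAt (x := z)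
  exact (f.hasFDerivAt z).add (((((((h 0).const_mul _).add ((h 1).const_mul _)).add
    ((h 2).const_mul _)).add (((h 0).mul (h 0)).const_mul _)).add
    (((h 0).mul (h 1)).const_mul _)).add (((h 1).mul (h 1)).const_mul _))

variable {e : Fin 3 → E} {m : Fin 3 → E →L[ℝ] ℝ}

theorem dir_zero_add_polyPert (hm : ∀ i j, m i (e j) = if i = j then 1 else 0) (p : PolyParam)
    (f : SmoothFn E) (z : E) : (f + polyPert m p).dir (e 0) z =
      f.dir (e 0) z + (p.1.1 0 + p.1.2 * m 0 z + p.2.1 * m 1 z) := by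
  change fderiv ℝ (f + polyPert m p).toFun z (e 0) = fderiv ℝ f.toFun z (e 0) + _
  rw [(hasFDerivAt_add_polyPert m p f z).fderiv]
  simp [hm]
  ring

theorem dir_one_add_polyPert (hm : ∀ i j, m i (e j) = if i = j then 1 else 0) (p : PolyParam)
    (f : SmoothFn E) (z : E) : (f + polyPert m p).dir (e 1) z =
      f.dir (e 1) z + (p.1.1 1 + p.2.1 * m 0 z + p.2.2 * m 1 z) := by
  change fderiv ℝ (f + polyPert m p).toFun z (e 1) = fderiv ℝ f.toFun z (e 1) + _
  rw [(hasFDerivAt_add_polyPert m p f z).fderiv]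
  simp [hm]
  ring

theorem dir_two_add_polyPert (hm : ∀ i j, m i (e j) = if i = j then 1 else 0) (p : PolyParam)
    (f : SmoothFn E) (z : E) : (f + polyPert m p).dir (e 2) z =
      f.dir (e 2) z + p.1.1 2 := by
  change fderiv ℝ (f + polyPert m p).toFun z (e 2) = fderiv ℝ f.toFun z (e 2) + _
  rw [(hasFDerivAt_add_polyPert m p f z).fderiv]
  simp [hm]

/-- The polynomials change first derivatives by affine functions and second ones by constants; the
latter is the case of zero forms. -/
theorem fderiv_add_affine (f : SmoothFn E) (g : SmoothFn E) (a b c : ℝ) (φ ψ : E →L[ℝ] ℝ)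
    (h : ∀ z, g z = f z + (a + b * φ z + c * ψ z)) (z w : E) :
    fderiv ℝ g.toFun z w = fderiv ℝ f.toFun z w + (b * φ w + c * ψ w) := by
  have h1 : HasFDerivAt g.toFun (fderiv ℝ f.toFun z + (b • φ + c • ψ)) z := by
    have h2 := (f.hasFDerivAt z).add
      (((φ.hasFDerivAt (x := z)).const_mul b |>.const_add a).add
        ((ψ.hasFDerivAt (x := z)).const_mul c))
    exact h2.congr_of_eventuallyEq (Filter.Eventually.of_forall h)
  rw [h1.fderiv]
  simp

/-- The Hessian of the polynomial is constant. -/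
theorem dir_dir_add_polyPert (hm : ∀ i j, m i (e j) = if i = j then 1 else 0) (p : PolyParam)
    (f : SmoothFn E) (z : E) :
    ((f + polyPert m p).dir (e 0)).dir (e 0) z = (f.dir (e 0)).dir (e 0) z + p.1.2 ∧
    ((f + polyPert m p).dir (e 0)).dir (e 1) z = (f.dir (e 0)).dir (e 1) z + p.2.1 ∧
    ((f + polyPert m p).dir (e 1)).dir (e 1) z = (f.dir (e 1)).dir (e 1) z + p.2.2 := by
  have h0 := fderiv_add_affine _ _ _ _ _ _ _ (dir_zero_add_polyPert hm p f) z
  have h1 := fderiv_add_affine _ _ _ _ _ _ _ (dir_one_add_polyPert hm p f) z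
  refine ⟨(h0 _).trans ?_, (h0 _).trans ?_, (h1 _).trans ?_⟩ <;> simp [hm] <;> rfl

theorem fderiv_dir_dir_add_polyPert (hm : ∀ i j, m i (e j) = if i = j then 1 else 0)
    (p : PolyParam) (f : SmoothFn E) (z w : E) :
    fderiv ℝ (((f + polyPert m p).dir (e 0)).dir (e 0)).toFun z w =
      fderiv ℝ ((f.dir (e 0)).dir (e 0)).toFun z w ∧
    fderiv ℝ (((f + polyPert m p).dir (e 0)).dir (e 1)).toFun z w =
      fderiv ℝ ((f.dir (e 0)).dir (e 1)).toFun z w ∧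
    fderiv ℝ (((f + polyPert m p).dir (e 1)).dir (e 1)).toFun z w =
      fderiv ℝ ((f.dir (e 1)).dir (e 1)).toFun z w := by
  have h := dir_dir_add_polyPert hm p f
  refine ⟨?_, ?_, ?_⟩
  · rw [fderiv_add_affine ((f.dir (e 0)).dir (e 0)) _ p.1.2 0 0 0 0 (by simp [(h _).1])]; simp
  · rw [fderiv_add_affine ((f.dir (e 0)).dir (e 1)) _ p.2.1 0 0 0 0 (by simp [(h _).2.1])]; simp
  · rw [fderiv_add_affine ((f.dir (e 1)).dir (e 1)) _ p.2.2 0 0 0 0 (by simp [(h _).2.2])]; simp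

end QuadraticPerturbation

/-- A singular symmetric `2 × 2` matrix is `± u uᵀ`. -/
theorem exists_rank_one_of_det_eq_zero {a b c : ℝ} (h : a * c = b * b) :
    ∃ σ : ℝ, (σ = 1 ∨ σ = -1) ∧ ∃ u v : ℝ, a = σ * (u * u) ∧ b = σ * (u * v) ∧ c = σ * (v * v) := by
  rcases eq_or_ne a 0 with ha | ha
  · have hb : b = 0 := by
      rw [ha, zero_mul] at h
      exact mul_self_eq_zero.1 h.symm
    rcases le_total 0 c with hc | hc
    · exact ⟨1, Or.inl rfl, 0, √c, by simp [ha], by simp [hb], by simp [hc]⟩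
    · exact ⟨-1, Or.inr rfl, 0, √(-c), by simp [ha], by simp [hb],
        by rw [mul_self_sqrt (by linarith)]; ring⟩
  · have key : ∀ σ : ℝ, (σ = 1 ∨ σ = -1) → 0 < σ * a →
        ∃ u v : ℝ, a = σ * (u * u) ∧ b = σ * (u * v) ∧ c = σ * (v * v) := by
      intro σ hσ hpos
      have hσ2 : σ * σ = 1 := by rcases hσ with rfl | rfl <;> norm_num
      have hs : √(σ * a) * √(σ * a) = σ * a := mul_self_sqrt hpos.le
      have hs0 : √(σ * a) ≠ 0 := (sqrt_pos.2 hpos).ne'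
      refine ⟨√(σ * a), σ * b / √(σ * a), ?_, ?_, ?_⟩
      · rw [hs, ← mul_assoc, hσ2, one_mul]
      · rw [mul_div_cancel₀ _ hs0, ← mul_assoc, hσ2, one_mul]
      · rw [div_mul_div_comm, hs]
        field_simp
        linear_combination h - b ^ 2 * hσ2
    rcases lt_or_gt_of_ne ha with hlt | hgt
    · exact ⟨-1, Or.inr rfl, key _ (Or.inr rfl) (by linarith)⟩
    · exact ⟨1, Or.inl rfl, key _ (Or.inl rfl) (by linarith)⟩

/-- The coordinate directions in the space of `(x, v, D, c)`. -/
def stdDir (i : Fin 3) : Q × ℝ := (Pi.single i 1, 0)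

/-- The coordinate forms on the space of `(x, v, D, c)`. -/
def stdForm (i : Fin 3) : Q × ℝ →L[ℝ] ℝ :=
  (ContinuousLinearMap.proj i).comp (ContinuousLinearMap.fst ℝ Q ℝ)

theorem stdForm_apply (i : Fin 3) (z : Q × ℝ) : stdForm i z = z.1 i := rfl

theorem stdForm_stdDir (i j : Fin 3) : stdForm i (stdDir j) = if i = j then 1 else 0 := by
  simp [stdForm_apply, stdDir, Pi.single_apply]

/-! ### Degenerate circles as critical values of the placement maps, and Sard's theorem. -/

section Sard

/-- For the Hessian `σ u uᵀ` at `z`, the parameters of the polynomials which put a parabolic circle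
with this Hessian at `z`. -/
def placement (σ : ℝ) (H : SmoothFn (Q × ℝ)) (y : PolyParam) : PolyParam :=
  let s₀₀ := σ * (y.2.1 * y.2.1) - (H.dir (stdDir 0)).dir (stdDir 0) y.1
  let s₀₁ := σ * (y.2.1 * y.2.2) - (H.dir (stdDir 0)).dir (stdDir 1) y.1
  let s₁₁ := σ * (y.2.2 * y.2.2) - (H.dir (stdDir 1)).dir (stdDir 1) y.1
  ((![-(H.dir (stdDir 0) y.1 + s₀₀ * stdForm 0 y.1 + s₀₁ * stdForm 1 y.1),
      -(H.dir (stdDir 1) y.1 + s₀₁ * stdForm 0 y.1 + s₁₁ * stdForm 1 y.1),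
      -H.dir (stdDir 2) y.1], s₀₀), s₀₁, s₁₁)

theorem differentiable_placement (σ : ℝ) (H : SmoothFn (Q × ℝ)) :
    Differentiable ℝ (placement σ H) := by
  have h (f : SmoothFn (Q × ℝ)) : Differentiable ℝ fun y : PolyParam => f y.1 :=
    f.differentiable.comp differentiable_fst
  have h0 (i) := h (H.dir (stdDir i))
  have h2 (i j) := h ((H.dir (stdDir i)).dir (stdDir j))
  have hf (i) : Differentiable ℝ fun y : PolyParam => stdForm i y.1 :=
    (stdForm i).differentiable.comp differentiable_fst
  have hu : Differentiable ℝ fun y : PolyParam => y.2.1 := by fun_prop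
  have hv : Differentiable ℝ fun y : PolyParam => y.2.2 := by fun_prop
  have h00 := ((hu.mul hu).const_mul σ).sub (h2 0 0)
  have h01 := ((hu.mul hv).const_mul σ).sub (h2 0 1)
  have h11 := ((hv.mul hv).const_mul σ).sub (h2 1 1)
  refine (Differentiable.prodMk (differentiable_pi.2 fun i => ?_) h00).prodMk (h01.prodMk h11)
  fin_cases i
  · exact (((h0 0).add (h00.mul (hf 0))).add (h01.mul (hf 1))).neg
  · exact (((h0 1).add (h01.mul (hf 0))).add (h11.mul (hf 1))).neg
  · exact (h0 2).neg

/-- Directions in which the placement map is stationary. -/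
theorem fderiv_placement_eq_zero (σ : ℝ) (H : SmoothFn (Q × ℝ)) (z w : Q × ℝ) (u v u' v' : ℝ)
    (p : PolyParam) (hp : placement σ H (z, u, v) = p)
    (h00 : σ * (2 * u * u') = fderiv ℝ ((H.dir (stdDir 0)).dir (stdDir 0)).toFun z w)
    (h01 : σ * (u * v' + u' * v) = fderiv ℝ ((H.dir (stdDir 0)).dir (stdDir 1)).toFun z w)
    (h11 : σ * (2 * v * v') = fderiv ℝ ((H.dir (stdDir 1)).dir (stdDir 1)).toFun z w)
    (h0 : fderiv ℝ (H.dir (stdDir 0)).toFun z w +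
      (p.1.2 * stdForm 0 w + p.2.1 * stdForm 1 w) = 0)
    (h1 : fderiv ℝ (H.dir (stdDir 1)).toFun z w +
      (p.2.1 * stdForm 0 w + p.2.2 * stdForm 1 w) = 0)
    (h2 : fderiv ℝ (H.dir (stdDir 2)).toFun z w = 0) :
    fderiv ℝ (placement σ H) (z, u, v) (w, u', v') = 0 := by
  -- The derivative in the direction `(w, u', v')` is computed along the line through `(z, u, v)`,
  -- as a one-variable derivative.
  have hline := ((differentiable_placement σ H) (z, u, v)).hasFDerivAt.hasLineDerivAt (w, u', v')
  refine hline.unique (?_ : HasDerivAt _ _ _)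
  have hf (f : SmoothFn (Q × ℝ)) :
      HasDerivAt (fun t : ℝ => f (z + t • w)) (fderiv ℝ f.toFun z w) 0 :=
    (f.hasFDerivAt z).hasLineDerivAt w
  have hm (i) : HasDerivAt (fun t : ℝ => stdForm i (z + t • w)) (stdForm i w) 0 :=
    ((stdForm i).hasFDerivAt (x := z)).hasLineDerivAt w
  have hl (a a' : ℝ) : HasDerivAt (fun t : ℝ => a + t * a') a' 0 := by
    simpa using ((hasDerivAt_id (0 : ℝ)).mul_const a').const_add a
  have k00 := (((hl u u').mul (hl u u')).const_mul σ).sub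
    (hf ((H.dir (stdDir 0)).dir (stdDir 0)))
  have k01 := (((hl u u').mul (hl v v')).const_mul σ).sub
    (hf ((H.dir (stdDir 0)).dir (stdDir 1)))
  have k11 := (((hl v v').mul (hl v v')).const_mul σ).sub
    (hf ((H.dir (stdDir 1)).dir (stdDir 1)))
  have c00 : p.1.2 = σ * (u * u) - (H.dir (stdDir 0)).dir (stdDir 0) z := by rw [← hp]; rfl
  have c01 : p.2.1 = σ * (u * v) - (H.dir (stdDir 0)).dir (stdDir 1) z := by rw [← hp]; rfl
  have c11 : p.2.2 = σ * (v * v) - (H.dir (stdDir 1)).dir (stdDir 1) z := by rw [← hp]; rfl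
  refine HasDerivAt.prodMk (HasDerivAt.prodMk (hasDerivAt_pi.2 fun i => ?_) ?_)
    (HasDerivAt.prodMk ?_ ?_)
  · fin_cases i
    · refine ((((hf (H.dir (stdDir 0))).add (k00.mul (hm 0))).add
        (k01.mul (hm 1))).neg).congr_deriv ?_
      rw [← h00, ← h01]
      simp
      linear_combination -h0 + stdForm 0 w * c00 + stdForm 1 w * c01
    · refine ((((hf (H.dir (stdDir 1))).add (k01.mul (hm 0))).add
        (k11.mul (hm 1))).neg).congr_deriv ?_
      rw [← h11, ← h01]
      simp
      linear_combination -h1 + stdForm 0 w * c01 + stdForm 1 w * c11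
    · exact (hf (H.dir (stdDir 2))).neg.congr_deriv (by simp [h2])
  · refine k00.congr_deriv ?_
    rw [← h00]
    simp
    ring
  · refine k01.congr_deriv ?_
    rw [← h01]
    simp
    ring
  · refine k11.congr_deriv ?_
    rw [← h11]
    simp
    ring

theorem det_eq_zero_of_apply_eq_zero {E : Type} [NormedAddCommGroup E] [NormedSpace ℝ E]
    [FiniteDimensional ℝ E] (L : E →L[ℝ] E) {w : E} (hw : w ≠ 0) (h : L w = 0) : L.det = 0 := by
  by_contra hdet
  have := (LinearMap.equivOfDetNeZero (L : E →ₗ[ℝ] E) hdet).injective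
  exact hw (this (by simpa using h))

/-- Degenerate parabolic circles come from critical values of the placement maps. -/
theorem exists_critical_of_not_injective (H : SmoothFn (Q × ℝ)) (p : PolyParam) (z : Q × ℝ)
    (hz : parabolicMap stdDir (H + polyPert stdForm p) z = 0)
    (hinj : ¬ Function.Injective (parabolicFDeriv stdDir (H + polyPert stdForm p) z)) :
    ∃ σ : ℝ, (σ = 1 ∨ σ = -1) ∧
      p ∈ placement σ H '' {y | (fderiv ℝ (placement σ H) y).det = 0} := by
  obtain ⟨hz0, hz1, hdet, hz2⟩ := (parabolicMap_eq_zero_iff _ _ _).1 hz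
  rw [dir_zero_add_polyPert stdForm_stdDir] at hz0
  rw [dir_one_add_polyPert stdForm_stdDir] at hz1
  rw [dir_two_add_polyPert stdForm_stdDir] at hz2
  obtain ⟨hN00, hN01, hN11⟩ := dir_dir_add_polyPert stdForm_stdDir p H z
  have hcomm := SmoothFn.dir_comm (H + polyPert stdForm p) (stdDir 1) (stdDir 0)
  change _ * _ - _ * _ = (0 : ℝ) at hdet
  rw [hcomm, sub_eq_zero] at hdet
  obtain ⟨σ, hσ, u, v, h00, h01, h11⟩ := exists_rank_one_of_det_eq_zero hdet
  have hσ2 : σ * σ = 1 := by rcases hσ with rfl | rfl <;> norm_num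
  have hplace : placement σ H (z, u, v) = p := by
    have e00 : σ * (u * u) - (H.dir (stdDir 0)).dir (stdDir 0) z = p.1.2 := by
      rw [← h00, hN00]; ring
    have e01 : σ * (u * v) - (H.dir (stdDir 0)).dir (stdDir 1) z = p.2.1 := by
      rw [← h01, hN01]; ring
    have e11 : σ * (v * v) - (H.dir (stdDir 1)).dir (stdDir 1) z = p.2.2 := by
      rw [← h11, hN11]; ring
    simp only [placement, e00, e01, e11]
    refine Prod.ext (Prod.ext ?_ rfl) rfl
    ext i
    fin_cases i
    · simp
      linarith
    · simp
      linarith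
    · simp
      linarith
  refine ⟨σ, hσ, (z, u, v), ?_, hplace⟩
  -- The kernel vector `w` is to be lifted to `(w, u', v')` in the kernel of the derivative of the
  -- placement map: the motion of `σ u uᵀ` has to match the derivative of the Hessian along `w`.
  obtain ⟨w, hw, hw0⟩ : ∃ w, parabolicFDeriv stdDir (H + polyPert stdForm p) z w = 0 ∧ w ≠ 0 := by
    by_contra hno
    push Not at hno
    exact hinj ((injective_iff_map_eq_zero _).2 hno)
  obtain ⟨hw1, hw2, hwdet, hw3⟩ := (parabolicFDeriv_eq_zero_iff _ _ _ _).1 hw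
  rw [fderiv_add_affine _ _ _ _ _ _ _ (dir_zero_add_polyPert stdForm_stdDir p H)] at hw1
  rw [fderiv_add_affine _ _ _ _ _ _ _ (dir_one_add_polyPert stdForm_stdDir p H)] at hw2
  rw [fderiv_add_affine (H.dir (stdDir 2)) _ (p.1.1 2) 0 0 0 0
    (by simp [dir_two_add_polyPert stdForm_stdDir p H])] at hw3
  simp only [zero_mul, add_zero] at hw3
  obtain ⟨x00, x01, x11⟩ := fderiv_dir_dir_add_polyPert stdForm_stdDir p H z w
  rw [fderiv_detDir, hcomm] at hwdet
  simp only [sub_apply, add_apply, smul_apply, smul_eq_mul, x00, x01, x11, h00, h01, h11] at hwdet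
  by_cases hu : u = 0
  · by_cases hv : v = 0
    -- At the vertex of the cone the placement map is quadratic in `(u, v)`, so moving `u` alone is
    -- stationary and no lift of `w` is needed.
    · refine det_eq_zero_of_apply_eq_zero _ (w := ((0 : Q × ℝ), (1 : ℝ), (0 : ℝ))) (by simp) ?_
      exact fderiv_placement_eq_zero σ H z 0 u v 1 0 p hplace (by simp [hu]) (by simp [hv])
        (by simp) (by simp) (by simp) (by simp)
    -- For `u = 0` the equations of the entries `01` and `11` are solved for `u', v'`; that of the
    -- entry `00` is then the vanishing of the derivative of `det` along `w`.
    · refine det_eq_zero_of_apply_eq_zero _ (w := (w,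
        (σ * fderiv ℝ ((H.dir (stdDir 0)).dir (stdDir 1)).toFun z w) / v,
        (σ * fderiv ℝ ((H.dir (stdDir 1)).dir (stdDir 1)).toFun z w) / (2 * v)))
        (by simp [hw0]) ?_
      refine fderiv_placement_eq_zero σ H z w u v _ _ p hplace ?_ ?_ ?_ hw1 hw2 hw3
      · have hvv : σ * v * v ≠ 0 := by
          rcases hσ with rfl | rfl <;> simp [hv]
        subst hu
        apply mul_left_cancel₀ hvv
        linear_combination -hwdet
      · subst hu
        field_simp
        linear_combination 2 * v * fderiv ℝ ((H.dir (stdDir 0)).dir (stdDir 1)).toFun z w * hσ2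
      · field_simp
        linear_combination fderiv ℝ ((H.dir (stdDir 1)).dir (stdDir 1)).toFun z w * hσ2
  · set X := fderiv ℝ ((H.dir (stdDir 0)).dir (stdDir 0)).toFun z w with hX
    set Y := fderiv ℝ ((H.dir (stdDir 0)).dir (stdDir 1)).toFun z w with hY
    set Z := fderiv ℝ ((H.dir (stdDir 1)).dir (stdDir 1)).toFun z w with hZ
    -- For `u ≠ 0` the entries `00` and `01` determine `u', v'`, and this relation, the derivative
    -- of `det` along `w`, supplies the entry `11`.
    have hdet' : u * u * Z = 2 * u * v * Y - v * v * X := by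
      linear_combination σ * hwdet + (-u * u * Z - v * v * X + 2 * u * v * Y) * hσ2
    refine det_eq_zero_of_apply_eq_zero _ (w := (w, σ * X / (2 * u),
      σ * (Y / u - v * X / (2 * u * u)))) (by simp [hw0]) ?_
    refine fderiv_placement_eq_zero σ H z w u v _ _ p hplace ?_ ?_ ?_ hw1 hw2 hw3
    · rw [← hX]
      field_simp
      linear_combination X * hσ2
    · rw [← hY]
      field_simp
      linear_combination 2 * u * Y * hσ2
    · rw [← hZ]
      field_simp
      linear_combination (2 * u * v * Y - v * v * X) * hσ2 - hdet'

/-- For almost every polynomial perturbation all parabolic circles are nondegenerate. -/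
theorem dense_nondegenerate (H : SmoothFn (Q × ℝ)) :
    Dense {p : PolyParam | ∀ z, parabolicMap stdDir (H + polyPert stdForm p) z = 0 →
      Function.Injective (parabolicFDeriv stdDir (H + polyPert stdForm p) z)} := by
  -- `PolyParam` serves as both source `(z, u, v)` and target of `placement`, so critical points are
  -- zeros of a Jacobian determinant and differentiability suffices for Sard.
  have hnull (σ : ℝ) : (MeasureTheory.Measure.addHaar : MeasureTheory.Measure PolyParam)
      (placement σ H '' {y | (fderiv ℝ (placement σ H) y).det = 0}) = 0 :=
    MeasureTheory.addHaar_image_eq_zero_of_det_fderivWithin_eq_zero _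
      (fun y _ => ((differentiable_placement σ H) y).hasFDerivAt.hasFDerivWithinAt)
      (fun y hy => hy)
  refine MeasureTheory.Measure.dense_of_ae (μ := MeasureTheory.Measure.addHaar) ?_
  have h1 := MeasureTheory.measure_eq_zero_iff_ae_notMem.1 (hnull 1)
  have h2 := MeasureTheory.measure_eq_zero_iff_ae_notMem.1 (hnull (-1))
  filter_upwards [h1, h2] with p hp1 hp2 z hz
  by_contra hinj
  obtain ⟨σ, rfl | rfl, hσ⟩ := exists_critical_of_not_injective H p z hz hinj
  · exact hp1 hσ
  · exact hp2 hσ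

end Sard

/-! ### Dynamical conditions expressed through `F` and the angular derivative of `H₁`. -/

section Translation

theorem pderiv_slice (f : SmoothFn (Q × ℝ)) (i : Fin 3) (c : ℝ) (q : Q) :
    pderiv i (fun q => f (q, c)) q = f.dir (stdDir i) (q, c) := by
  have h : HasFDerivAt (fun q => f (q, c)) _ q :=
    (f.hasFDerivAt (q, c)).comp q (hasFDerivAt_prodMk_left q c)
  change fderiv ℝ (fun q => f (q, c)) q (Pi.single i 1) = _
  rw [h.fderiv]
  rfl

theorem isCircleOfFixedPoints_iff {h : Q → ℝ} {q : Q} (hd : DifferentiableAt ℝ h q) :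
    IsCircleOfFixedPoints (fun p => h p.1) q ↔
      pderiv 0 h q = 0 ∧ pderiv 1 h q = 0 ∧ pderiv 2 h q = 0 := by
  have key (θ : ℝ) : hamVF (fun p => h p.1) (q, θ) =
      (![pderiv 1 h q, -pderiv 0 h q, 0], pderiv 2 h q) := by
    have hf : HasFDerivAt (fun p : Phase => h p.1) _ (q, θ) :=
      HasFDerivAt.comp (q, θ) (f := Prod.fst) hd.hasFDerivAt hasFDerivAt_fst
    simp [hamVF, hf.fderiv, pderiv]
  simp only [IsCircleOfFixedPoints, key, forall_const, Prod.ext_iff, funext_iff,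
    Fin.forall_fin_succ]
  simp
  tauto

theorem isParabolicCircle_iff (h : SmoothFn Q) (q : Q) :
    IsParabolicCircle h q ↔ parabolicMap (fun i => Pi.single i 1) h q = 0 := by
  rw [IsParabolicCircle, isCircleOfFixedPoints_iff (h.differentiable q), parabolicMap_eq_zero_iff,
    detHess, Matrix.det_fin_two]
  change ((_ ∧ _ ∧ _) ∧ detDir (fun i => Pi.single i 1) h q = 0) ↔ _
  constructor
  · rintro ⟨⟨h0, h1, h2⟩, hd⟩
    exact ⟨h0, h1, hd, h2⟩
  · rintro ⟨h0, h1, hd, h2⟩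
    exact ⟨⟨h0, h1, h2⟩, hd⟩

theorem pderiv_unperturbed (K : Family) (i : Fin 3) (c : ℝ) (q : Q) :
    pderiv i (K.unperturbed c) q = K.1.dir (stdDir i) (q, c) :=
  pderiv_slice K.1 i c q

theorem pderiv_pderiv_unperturbed (K : Family) (i j : Fin 3) (c : ℝ) (q : Q) :
    pderiv j (pderiv i (K.unperturbed c)) q = (K.1.dir (stdDir i)).dir (stdDir j) (q, c) := by
  rw [← pderiv_slice]
  congr 1
  ext q
  exact pderiv_unperturbed K i c q

theorem detHess_unperturbed (K : Family) (c : ℝ) (q : Q) :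
    detHess (K.unperturbed c) q = detDir stdDir K.1 (q, c) := by
  rw [detHess, Matrix.det_fin_two]
  simp only [Matrix.of_apply, pderiv_pderiv_unperturbed]
  rfl

theorem hasParabolicCircle_iff (K : Family) (z : Q × ℝ) :
    K.HasParabolicCircle z ↔ parabolicMap stdDir K.1 z = 0 := by
  have hd : DifferentiableAt ℝ (K.unperturbed z.2) z.1 :=
    ((K.1.hasFDerivAt (z.1, z.2)).comp z.1 (hasFDerivAt_prodMk_left z.1 z.2)).differentiableAt
  rw [Family.HasParabolicCircle, IsParabolicCircle, isCircleOfFixedPoints_iff hd,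
    parabolicMap_eq_zero_iff, detHess_unperturbed]
  simp only [pderiv_unperturbed]
  tauto

theorem finrank_reduced : Module.finrank ℝ (Q × ℝ) = 4 := by simp

theorem isTransverseAt_iff (K : Family) (z : Q × ℝ) :
    K.IsTransverseAt z ↔ Function.Injective (parabolicFDeriv stdDir K.1 z) := by
  have h := linearIndependent_iff_injective_pi finrank_reduced
    (fun i => fderiv ℝ (parabolicComp stdDir K.1 i).toFun z)
  rw [Family.IsTransverseAt, parabolicFDeriv, ← h]
  simp only [pderiv_unperturbed, detHess_unperturbed]
  have : (fun i => fderiv ℝ (parabolicComp stdDir K.1 i).toFun z) =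
      ![fderiv ℝ (K.1.dir (stdDir 0)).toFun z, fderiv ℝ (K.1.dir (stdDir 1)).toFun z,
        fderiv ℝ (detDir stdDir K.1).toFun z, fderiv ℝ (K.1.dir (stdDir 2)).toFun z] := by
    funext i
    fin_cases i <;> rfl
  rw [this]

/-- The derivative of the perturbing term along the angle, at `ε = 0`. -/
def kick (P : Perturbation) (q : Q) (θ : ℝ) : ℝ :=
  P.toSmoothFn.dir ((0 : Q), (1 : ℝ), (0 : ℝ)) (q, θ, 0)

/-- `H₀` is independent of the angle, so `D' = -ε ∂H₁/∂θ`; differentiating the product at `ε = 0`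
leaves only the value of `∂H₁/∂θ` there. -/
theorem deriv_hamVF (K : Family) (c : ℝ) (q : Q) (θ : ℝ) :
    deriv (fun ε : ℝ => (hamVF (K.ham c ε) (q, θ)).1 2) 0 = -kick K.2 q θ := by
  set g := K.2.toSmoothFn.dir ((0 : Q), (1 : ℝ), (0 : ℝ)) with hg
  have key (ε : ℝ) : (hamVF (K.ham c ε) (q, θ)).1 2 = -(ε * g (q, θ, ε)) := by
    have h0 : HasFDerivAt (fun q => K.1 (q, c)) _ q :=
      (K.1.hasFDerivAt (q, c)).comp q (hasFDerivAt_prodMk_left q c)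
    have h1 : HasFDerivAt (fun p : Phase => K.1 (p.1, c)) _ (q, θ) :=
      HasFDerivAt.comp (q, θ) (f := Prod.fst) h0 hasFDerivAt_fst
    have h2 : HasFDerivAt (fun p : Phase => K.2.toFun (p.1, p.2, ε)) _ (q, θ) :=
      HasFDerivAt.comp (q, θ) (f := fun p : Phase => (p.1, p.2, ε))
        (K.2.toSmoothFn.hasFDerivAt (q, θ, ε))
        (hasFDerivAt_fst.prodMk (hasFDerivAt_snd.prodMk (hasFDerivAt_const ε (q, θ))))
    have h3 : HasFDerivAt (K.ham c ε) _ (q, θ) := h1.add (h2.const_mul ε)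
    change -fderiv ℝ (K.ham c ε) (q, θ) (0, 1) = _
    rw [h3.fderiv]
    have h4 : fderiv ℝ K.1.toFun (q, c) ((0 : Q), (0 : ℝ)) = 0 := map_zero _
    simp [hg, SmoothFn.dir, h4]
  simp_rw [key]
  have h1 : HasDerivAt (fun ε : ℝ => (q, θ, ε)) ((0 : Q), (0 : ℝ), (1 : ℝ)) 0 :=
    (hasDerivAt_const (0 : ℝ) q).prodMk ((hasDerivAt_const (0 : ℝ) θ).prodMk (hasDerivAt_id 0))
  have h2 : HasDerivAt (fun ε : ℝ => g (q, θ, ε)) _ 0 :=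
    (g.hasFDerivAt (q, θ, 0)).comp_hasDerivAt 0 h1
  have h3 : HasDerivAt (fun ε : ℝ => -(ε * g (q, θ, ε))) _ 0 :=
    ((hasDerivAt_id (0 : ℝ)).mul h2).neg
  rw [h3.deriv]
  simp [kick, hg]

theorem hasTransverseResonance_iff (K : Family) (z : Q × ℝ) :
    K.HasTransverseResonance z ↔ parabolicMap stdDir K.1 z = 0 ∧
      Function.Injective (parabolicFDeriv stdDir K.1 z) ∧ ∃ θ, kick K.2 z.1 θ ≠ 0 := by
  rw [Family.HasTransverseResonance, Family.HasParabolicResonance, hasParabolicCircle_iff,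
    isTransverseAt_iff]
  simp only [deriv_hamVF, neg_ne_zero]
  tauto

theorem continuous_kick (θ : ℝ) : Continuous (fun p : Perturbation × Q => kick p.1 p.2 θ) := by
  have h1 : Continuous Perturbation.toSmoothFn := continuous_induced_dom
  exact (SmoothFn.continuous_dir_eval _).comp
    ((h1.comp continuous_fst).prodMk (continuous_snd.prodMk continuous_const))

theorem continuous_family_parabolicMap :
    Continuous (fun p : Family × (Q × ℝ) => parabolicMap stdDir p.1.1 p.2) :=
  (continuous_parabolicMap stdDir).comp
    ((continuous_fst.comp continuous_fst).prodMk continuous_snd)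

theorem continuous_family_parabolicFDeriv :
    Continuous (fun p : Family × (Q × ℝ) => parabolicFDeriv stdDir p.1.1 p.2) :=
  (continuous_parabolicFDeriv stdDir).comp
    ((continuous_fst.comp continuous_fst).prodMk continuous_snd)

theorem continuous_family_kick (θ : ℝ) :
    Continuous (fun p : Family × (Q × ℝ) => kick p.1.2 p.2.1 θ) :=
  (continuous_kick θ).comp
    ((continuous_snd.comp continuous_fst).prodMk (continuous_fst.comp continuous_snd))

end Translation

/-! ### Persistence and openness of transverse resonances. -/

section Persistence

theorem transverseResonance_persists (K : Family) (z : Q × ℝ) (h : K.HasTransverseResonance z)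
    (V : Set (Q × ℝ)) (hV : V ∈ 𝓝 z) :
    ∃ W ∈ 𝓝 z, W ⊆ V ∧ ∀ᶠ K' in 𝓝 K, ∃ z' ∈ W,
      K'.HasTransverseResonance z' ∧ ∀ y ∈ W, K'.HasParabolicCircle y → y = z' := by
  obtain ⟨h0, hinj, θ, hθ⟩ := (hasTransverseResonance_iff K z).1 h
  have hV' : ∀ᶠ p : Family × (Q × ℝ) in 𝓝 (K, z), p.2 ∈ V :=
    continuous_snd.continuousAt (x := (K, z)) hV
  -- One angle `θ` at which the circle is perturbed works for all nearby families and points.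
  have hP : ∀ᶠ p : Family × (Q × ℝ) in 𝓝 (K, z), p.2 ∈ V ∧ kick p.1.2 p.2.1 θ ≠ 0 :=
    hV'.and ((continuous_family_kick θ).continuousAt.eventually_ne hθ)
  obtain ⟨W, hW, hWP, hev⟩ := nondegenerate_zero_persists finrank_reduced
    (fun K : Family => parabolicMap stdDir K.1) (fun K => parabolicFDeriv stdDir K.1)
    (fun K z => hasFDerivAt_parabolicMap stdDir K.1 z) continuous_family_parabolicMap
    continuous_family_parabolicFDeriv h0 hinj
    (P := fun K y => y ∈ V ∧ kick K.2 y.1 θ ≠ 0) hP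
  refine ⟨W, hW, fun y hy => (hWP y hy).1, hev.mono ?_⟩
  rintro K' ⟨z', hz', hz0, hall⟩
  exact ⟨z', hz', (hasTransverseResonance_iff K' z').2
    ⟨hz0, (hall z' hz').2.1, θ, (hall z' hz').1.2⟩,
    fun y hy hc => (hall y hy).2.2 ((hasParabolicCircle_iff K' y).1 hc)⟩

theorem isOpen_exists_transverseResonance {V : Set (Q × ℝ)} (hV : IsOpen V) :
    IsOpen {K : Family | ∃ z ∈ V, K.HasTransverseResonance z} := by
  refine isOpen_iff_mem_nhds.2 ?_
  rintro K ⟨z, hz, h⟩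
  obtain ⟨W, -, hWV, hev⟩ := transverseResonance_persists K z h V (hV.mem_nhds hz)
  filter_upwards [hev] with K' ⟨z', hz', h', _⟩
  exact ⟨z', hWV hz', h'⟩

theorem isOpen_exists_nondegenerate {V : Set (Q × ℝ)} (hV : IsOpen V) :
    IsOpen {H : SmoothFn (Q × ℝ) | ∃ z ∈ V, parabolicMap stdDir H z = 0 ∧
      Function.Injective (parabolicFDeriv stdDir H z)} := by
  refine isOpen_iff_mem_nhds.2 ?_
  rintro H ⟨z, hz, h0, hinj⟩
  obtain ⟨W, -, hWV, hev⟩ := nondegenerate_zero_persists finrank_reduced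
    (fun H : SmoothFn (Q × ℝ) => parabolicMap stdDir H) (fun H => parabolicFDeriv stdDir H)
    (fun H z => hasFDerivAt_parabolicMap stdDir H z) (continuous_parabolicMap stdDir)
    (continuous_parabolicFDeriv stdDir) h0 hinj (P := fun _ y => y ∈ V)
    (continuous_snd.continuousAt (x := (H, z)) (hV.mem_nhds hz))
  filter_upwards [hev] with H' ⟨z', hz', h', hall⟩
  exact ⟨z', hWV z' hz', h', (hall z' hz').2.1⟩

end Persistence

/-! ### Generic families. -/

section Generic

/-- Nondegenerate zeros do not accumulate. -/
theorem finite_nondegenerate_zeros {E F : Type} [NormedAddCommGroup E] [NormedSpace ℝ E]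
    [FiniteDimensional ℝ E] [NormedAddCommGroup F] [NormedSpace ℝ F] {f : E → F}
    {f' : E → E →L[ℝ] F} (hf : ∀ z, HasFDerivAt f (f' z) z)
    (hinj : ∀ z, f z = 0 → Function.Injective (f' z)) {C : Set E} (hC : IsCompact C) :
    {z ∈ C | f z = 0}.Finite := by
  have key : ∀ z, {y | f y = 0 → y = z} ∈ 𝓝 z := by
    intro z
    by_cases hz : f z = 0
    -- An injective derivative in finite dimension is bounded below, which excludes further zeros
    -- near `z`.
    · obtain ⟨k, -, hk⟩ := (f' z : E →ₗ[ℝ] F).exists_antilipschitzWith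
        (LinearMap.ker_eq_bot.2 (hinj z hz))
      have h := (hf z).eventually_ne (c := 0)
        ⟨k, hk⟩
      filter_upwards [eventually_nhdsWithin_iff.1 h] with y hy h0
      by_contra hne
      exact hy hne h0
    · filter_upwards [(hf z).continuousAt.eventually_ne hz] with y hy h0
      exact absurd h0 hy
  obtain ⟨t, -, ht⟩ := hC.elim_nhds_subcover _ fun z _ => key z
  refine t.finite_toSet.subset ?_
  rintro y ⟨hy, h0⟩
  obtain ⟨z, hz, hyz⟩ := Set.mem_iUnion₂.1 (ht hy)
  rw [hyz h0]
  exact hz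

theorem countable_nondegenerate_zeros {E F : Type} [NormedAddCommGroup E] [NormedSpace ℝ E]
    [FiniteDimensional ℝ E] [NormedAddCommGroup F] [NormedSpace ℝ F] {f : E → F}
    {f' : E → E →L[ℝ] F} (hf : ∀ z, HasFDerivAt f (f' z) z)
    (hinj : ∀ z, f z = 0 → Function.Injective (f' z)) : {z | f z = 0}.Countable := by
  have : ProperSpace E := FiniteDimensional.proper_real E
  refine (Set.countable_iUnion fun n : ℕ => (finite_nondegenerate_zeros hf hinj
    (isCompact_closedBall (0 : E) n)).countable).mono ?_
  intro z hz
  obtain ⟨n, hn⟩ := exists_nat_ge ‖z‖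
  exact Set.mem_iUnion.2 ⟨n, by simpa using hn, hz⟩

/-- A property which is open in the function and the point jointly and holds for a dense set of
functions at all points is a dense `Gδ` property. -/
theorem isGeneric_forall {X E : Type} [TopologicalSpace X] [NormedAddCommGroup E]
    [NormedSpace ℝ E] [FiniteDimensional ℝ E] {P : X → E → Prop}
    (hP : IsOpen {p : X × E | P p.1 p.2}) (hd : Dense {x | ∀ z, P x z}) :
    IsGeneric {x | ∀ z, P x z} := by
  have : ProperSpace E := FiniteDimensional.proper_real E
  refine ⟨residual_of_dense_Gδ ?_ hd, hd⟩
  have heq : {x | ∀ z, P x z} = ⋂ n : ℕ, {x | ∀ z ∈ Metric.closedBall (0 : E) n, P x z} := by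
    ext x
    simp only [Set.mem_ofPred_eq, Set.mem_iInter]
    refine ⟨fun h n z _ => h z, fun h z => ?_⟩
    obtain ⟨n, hn⟩ := exists_nat_ge ‖z‖
    exact h n z (by simpa using hn)
  rw [heq]
  refine IsGδ.iInter_of_isOpen fun n => isOpen_iff_mem_nhds.2 fun x hx => ?_
  -- The tube lemma: an open condition that holds on a compact ball persists for nearby `x`.
  exact (isCompact_closedBall (0 : E) n).eventually_forall_of_forall_eventually
    fun z hz => hP.mem_nhds (hx z hz)

/-- The function `sin θ` of `((x, v, D), θ, ε)`. -/
def sinAngle : SmoothFn (Q × ℝ × ℝ) := ⟨fun y => sin y.2.1, by fun_prop⟩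

/-- The perturbing term `P + t sin θ`. -/
def addSin (P : Perturbation) (t : ℝ) : Perturbation where
  toSmoothFn := P.toSmoothFn + t • sinAngle
  periodic q ε θ := by
    have := P.periodic q ε θ
    simp only [SmoothFn.add_apply, SmoothFn.smul_apply, sinAngle, sin_add_two_pi] at this ⊢
    rw [this]

theorem continuous_addSin (P : Perturbation) : Continuous (addSin P) := by
  have h : Continuous fun t : ℝ => P.toSmoothFn + t • sinAngle :=
    continuous_const.add (continuous_id.smul continuous_const)
  exact continuous_induced_rng.2 h

theorem addSin_zero (P : Perturbation) : addSin P 0 = P := by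
  cases P
  refine (Perturbation.mk.injEq ..).mpr (SmoothFn.ext fun z => ?_)
  simp

theorem kick_addSin (P : Perturbation) (t : ℝ) (q : Q) : kick (addSin P t) q 0 = kick P q 0 + t := by
  have h1 : HasFDerivAt (fun y : Q × ℝ × ℝ => sin y.2.1) _ (q, (0 : ℝ), (0 : ℝ)) :=
    HasFDerivAt.sin (hasFDerivAt_snd.fst)
  have h2 : HasFDerivAt (addSin P t).toSmoothFn.toFun _ (q, (0 : ℝ), (0 : ℝ)) :=
    (P.toSmoothFn.hasFDerivAt (q, 0, 0)).add (h1.const_mul t)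
  change fderiv ℝ (addSin P t).toSmoothFn.toFun (q, 0, 0) (0, 1, 0) = _
  rw [h2.fderiv]
  simp [kick, SmoothFn.dir]

theorem continuous_perturb (K : Family) : Continuous fun y : PolyParam × ℝ =>
    ((K.1 + polyPert stdForm y.1, addSin K.2 y.2) : Family) :=
  (continuous_const.add ((continuous_polyPert stdForm).comp continuous_fst)).prodMk
    ((continuous_addSin K.2).comp continuous_snd)

/-- The order of choices matters: once `p` makes all zeros nondegenerate they are countable and do
not depend on `t`. As `t sin θ` adds `t` to the angular derivative at `θ = 0`, only countably many
`t` fail. -/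
theorem dense_transverse_perturb (K : Family) : Dense {y : PolyParam × ℝ |
    ∀ z, Family.HasParabolicCircle (K.1 + polyPert stdForm y.1, addSin K.2 y.2) z →
      Family.HasTransverseResonance (K.1 + polyPert stdForm y.1, addSin K.2 y.2) z} := by
  rintro ⟨p₀, t₀⟩
  rw [mem_closure_iff_nhds]
  intro U hU
  obtain ⟨A, hA, B, hB, hAB⟩ := mem_nhds_prod_iff.1 hU
  obtain ⟨p, hpA, hp⟩ := mem_closure_iff_nhds.1 (dense_nondegenerate K.1 p₀) A hA
  have hcount := countable_nondegenerate_zeros (fun z => hasFDerivAt_parabolicMap stdDir _ z) hp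
  obtain ⟨t, htB, ht⟩ := mem_closure_iff_nhds.1
    ((hcount.image fun z => -kick K.2 z.1 0).dense_compl ℝ t₀) B hB
  refine ⟨(p, t), hAB (Set.mk_mem_prod hpA htB), fun z hz => ?_⟩
  have hz0 := (hasParabolicCircle_iff _ z).1 hz
  refine (hasTransverseResonance_iff _ z).2 ⟨hz0, hp z hz0, 0, fun hk => ht ⟨z, hz0, ?_⟩⟩
  have hk' : kick K.2 z.1 0 + t = 0 := (kick_addSin K.2 t z.1).symm.trans hk
  change -kick K.2 z.1 0 = t
  linarith

theorem dense_all_transverse :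
    Dense {K : Family | ∀ z, K.HasParabolicCircle z → K.HasTransverseResonance z} := by
  intro K
  have h := map_mem_closure (continuous_perturb K) (dense_transverse_perturb K (0, 0))
    (t := {K : Family | ∀ z, K.HasParabolicCircle z → K.HasTransverseResonance z})
    fun y hy => hy
  rwa [polyPert_zero, addSin_zero] at h

theorem isGeneric_all_transverse :
    IsGeneric {K : Family | ∀ z, K.HasParabolicCircle z → K.HasTransverseResonance z} := by
  refine isGeneric_forall ?_ dense_all_transverse
  -- Written without implication, the condition is visibly open in the family and the point.
  have heq : {p : Family × (Q × ℝ) | p.1.HasParabolicCircle p.2 →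
      p.1.HasTransverseResonance p.2} = {p | parabolicMap stdDir p.1.1 p.2 ≠ 0} ∪
      ({p | Function.Injective (parabolicFDeriv stdDir p.1.1 p.2)} ∩
        ⋃ θ, {p | kick p.1.2 p.2.1 θ ≠ 0}) := by
    ext p
    simp only [Set.mem_ofPred_eq, hasParabolicCircle_iff, hasTransverseResonance_iff,
      Set.mem_union, Set.mem_inter_iff, Set.mem_iUnion]
    tauto
  rw [heq]
  refine (isOpen_ne_fun continuous_family_parabolicMap continuous_const).union
    (IsOpen.inter ?_ (isOpen_iUnion fun θ =>
      isOpen_ne_fun (continuous_family_kick θ) continuous_const))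
  exact ContinuousLinearMap.isOpen_injective.preimage continuous_family_parabolicFDeriv

theorem finite_parabolicCircles {K : Family}
    (hK : ∀ z, K.HasParabolicCircle z → K.HasTransverseResonance z) {C : Set (Q × ℝ)}
    (hC : IsCompact C) : {z ∈ C | K.HasParabolicCircle z}.Finite := by
  simp only [hasParabolicCircle_iff, hasTransverseResonance_iff] at hK ⊢
  exact finite_nondegenerate_zeros (fun z => hasFDerivAt_parabolicMap stdDir _ z)
    (fun z hz => (hK z hz).2.1) hC

end Generic

/-! ### Integrable Hamiltonians without parameter. -/

section SingleHamiltonian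

/-- A Hamiltonian without parameter as a family with trivial dependence on the parameter. -/
def constFamily (h : SmoothFn Q) : SmoothFn (Q × ℝ) := ⟨fun z => h z.1, h.smooth.comp contDiff_fst⟩

theorem fderiv_constFamily (h : SmoothFn Q) (z w : Q × ℝ) :
    fderiv ℝ (constFamily h).toFun z w = fderiv ℝ h.toFun z.1 w.1 := by
  have hf : HasFDerivAt (constFamily h).toFun _ z :=
    HasFDerivAt.comp z (f := Prod.fst) (h.hasFDerivAt z.1) hasFDerivAt_fst
  rw [hf.fderiv]
  rfl

theorem dir_constFamily (h : SmoothFn Q) (i : Fin 3) :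
    (constFamily h).dir (stdDir i) = constFamily (h.dir (Pi.single i 1)) :=
  SmoothFn.ext fun z => fderiv_constFamily h z (stdDir i)

theorem parabolicComp_constFamily (h : SmoothFn Q) (i : Fin 4) :
    parabolicComp stdDir (constFamily h) i =
      constFamily (parabolicComp (fun i => Pi.single i 1) h i) := by
  fin_cases i
  · exact dir_constFamily h 0
  · exact dir_constFamily h 1
  · refine SmoothFn.ext fun z => ?_
    change _ * _ - _ * _ = _
    simp only [dir_constFamily]
    rfl
  · exact dir_constFamily h 2

theorem dense_no_parabolicCircle : Dense {h : SmoothFn Q | ∀ q : Q, ¬ IsParabolicCircle h q} := by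
  intro h
  rw [mem_closure_iff_nhds]
  intro U hU
  let m : Fin 3 → Q →L[ℝ] ℝ := fun i => ContinuousLinearMap.proj i
  have hcont : Continuous fun p : PolyParam => h + polyPert m p :=
    continuous_const.add (continuous_polyPert m)
  have hU' : U ∈ 𝓝 (h + polyPert m 0) := by rwa [polyPert_zero]
  -- The polynomials do not involve `c`, so the perturbed family is still constant in `c`.
  obtain ⟨p, hpU, hp⟩ := mem_closure_iff_nhds.1 (dense_nondegenerate (constFamily h) 0) _
    (hcont.continuousAt hU')
  refine ⟨h + polyPert m p, hpU, fun q hq => ?_⟩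
  have heq : constFamily h + polyPert stdForm p = constFamily (h + polyPert m p) :=
    SmoothFn.ext fun z => rfl
  rw [isParabolicCircle_iff] at hq
  simp only [Set.mem_ofPred_eq, heq] at hp
  have hinj := hp (q, 0) <| by
    ext i
    rw [parabolicMap, parabolicComp_constFamily]
    exact congrFun hq i
  -- The direction of `c` is always in the kernel, so a nondegenerate zero is impossible.
  have h01 : ((0 : Q), (1 : ℝ)) = 0 := by
    apply hinj
    ext i
    simp only [parabolicFDeriv, parabolicComp_constFamily, ContinuousLinearMap.coe_pi',
      fderiv_constFamily, map_zero]
    rfl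
  simp at h01

theorem isGeneric_no_parabolicCircle :
    IsGeneric {h : SmoothFn Q | ∀ q : Q, ¬ IsParabolicCircle h q} := by
  refine isGeneric_forall ?_ dense_no_parabolicCircle
  simp only [isParabolicCircle_iff]
  exact isOpen_ne_fun (continuous_parabolicMap _) continuous_const

end SingleHamiltonian

/-! ### A model resonance, its implantation, and density of occurrence. -/

section Model

/-- The model `V² / 2 + X³ / 3 + C X + Y² / 2` of a family with a nondegenerate parabolic circle,
where `(X, V, Y, C)` are the coordinates centred at `a`. -/
def model (a : Q × ℝ) : SmoothFn (Q × ℝ) where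
  toFun z := (z.1 1 - a.1 1) ^ 2 / 2 + (z.1 0 - a.1 0) ^ 3 / 3 +
    (z.2 - a.2) * (z.1 0 - a.1 0) + (z.1 2 - a.1 2) ^ 2 / 2
  smooth := by fun_prop

theorem hasFDerivAt_coord_sub (a z : Q × ℝ) (i : Fin 3) :
    HasFDerivAt (fun z : Q × ℝ => z.1 i - a.1 i) (stdForm i) z :=
  ((stdForm i).hasFDerivAt (x := z)).sub_const (a.1 i)

theorem fderiv_model (a z w : Q × ℝ) : fderiv ℝ (model a).toFun z w =
    (z.1 1 - a.1 1) * w.1 1 + ((z.1 0 - a.1 0) ^ 2 + (z.2 - a.2)) * w.1 0 +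
      (z.1 0 - a.1 0) * w.2 + (z.1 2 - a.1 2) * w.1 2 := by
  have h := hasFDerivAt_coord_sub a z
  have hc : HasFDerivAt (fun z : Q × ℝ => z.2 - a.2) (ContinuousLinearMap.snd ℝ Q ℝ) z :=
    hasFDerivAt_snd.sub_const a.2
  have hf : HasFDerivAt (model a).toFun _ z :=
    (((((h 1).pow 2).mul_const 2⁻¹).add (((h 0).pow 3).mul_const 3⁻¹)).add
      (hc.mul (h 0))).add (((h 2).pow 2).mul_const 2⁻¹)
  rw [hf.fderiv]
  simp [stdForm_apply]
  ring

theorem dir_model (a z : Q × ℝ) :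
    (model a).dir (stdDir 0) z = (z.1 0 - a.1 0) ^ 2 + (z.2 - a.2) ∧
    (model a).dir (stdDir 1) z = z.1 1 - a.1 1 ∧ (model a).dir (stdDir 2) z = z.1 2 - a.1 2 := by
  refine ⟨(fderiv_model a z _).trans ?_, (fderiv_model a z _).trans ?_,
    (fderiv_model a z _).trans ?_⟩ <;> simp [stdDir]

theorem fderiv_dir_model (a z w : Q × ℝ) :
    fderiv ℝ ((model a).dir (stdDir 0)).toFun z w = 2 * (z.1 0 - a.1 0) * w.1 0 + w.2 ∧
    fderiv ℝ ((model a).dir (stdDir 1)).toFun z w = w.1 1 ∧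
    fderiv ℝ ((model a).dir (stdDir 2)).toFun z w = w.1 2 := by
  have h := hasFDerivAt_coord_sub a z
  have hc : HasFDerivAt (fun z : Q × ℝ => z.2 - a.2) (ContinuousLinearMap.snd ℝ Q ℝ) z :=
    hasFDerivAt_snd.sub_const a.2
  refine ⟨?_, ?_, ?_⟩
  · rw [funext fun z => (dir_model a z).1]
    have h0 : HasFDerivAt (fun z : Q × ℝ => (z.1 0 - a.1 0) ^ 2 + (z.2 - a.2)) _ z :=
      ((h 0).pow 2).add hc
    rw [h0.fderiv]
    simp [stdForm_apply]
  · rw [funext fun z => (dir_model a z).2.1, (h 1).fderiv]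
    rfl
  · rw [funext fun z => (dir_model a z).2.2, (h 2).fderiv]
    rfl

theorem detDir_model (a z : Q × ℝ) : detDir stdDir (model a) z = 2 * (z.1 0 - a.1 0) := by
  have h := fderiv_dir_model a z
  change fderiv ℝ ((model a).dir (stdDir 0)).toFun z (stdDir 0) *
    fderiv ℝ ((model a).dir (stdDir 1)).toFun z (stdDir 1) -
    fderiv ℝ ((model a).dir (stdDir 0)).toFun z (stdDir 1) *
    fderiv ℝ ((model a).dir (stdDir 1)).toFun z (stdDir 0) = _
  rw [(h _).1, (h _).1, (h _).2.1, (h _).2.1]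
  simp [stdDir]

theorem parabolicMap_model (a : Q × ℝ) : parabolicMap stdDir (model a) a = 0 := by
  rw [parabolicMap_eq_zero_iff, (dir_model a a).1, (dir_model a a).2.1, (dir_model a a).2.2,
    detDir_model]
  simp

/-- At the centre the four differentials are `dC`, `dV`, `2 dX` and `dY`. -/
theorem injective_parabolicFDeriv_model (a : Q × ℝ) :
    Function.Injective (parabolicFDeriv stdDir (model a) a) := by
  refine (injective_iff_map_eq_zero _).2 fun w hw => ?_
  rw [parabolicFDeriv_eq_zero_iff] at hw
  obtain ⟨h0, h1, hd, h2⟩ := hw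
  have hdet : fderiv ℝ (detDir stdDir (model a)).toFun a w = 2 * w.1 0 := by
    rw [funext (detDir_model a), ((hasFDerivAt_coord_sub a a 0).const_mul 2).fderiv]
    rfl
  rw [hdet] at hd
  rw [(fderiv_dir_model a a w).1] at h0
  rw [(fderiv_dir_model a a w).2.1] at h1
  rw [(fderiv_dir_model a a w).2.2] at h2
  simp only [sub_self, mul_zero, zero_mul, zero_add] at h0
  refine Prod.ext (funext fun i => ?_) h0
  fin_cases i
  · simpa using hd
  · exact h1
  · exact h2

/-- `H`, replaced by the model near `a`. -/
def implant (H : SmoothFn (Q × ℝ)) (a : Q × ℝ) (χ : ContDiffBump a) : SmoothFn (Q × ℝ) where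
  toFun z := χ z * model a z + (1 - χ z) * H z
  smooth := (χ.contDiff.mul (model a).smooth).add ((contDiff_const.sub χ.contDiff).mul H.smooth)

/-- The model is implanted at points tending to infinity. On each compact set the modified functions
eventually agree with `H`, hence converge to it. -/
theorem dense_exists_nondegenerate :
    Dense {H : SmoothFn (Q × ℝ) | ∃ z, parabolicMap stdDir H z = 0 ∧
      Function.Injective (parabolicFDeriv stdDir H z)} := by
  intro H
  let a : ℕ → Q × ℝ := fun n => (0, (n : ℝ))
  let χ : ∀ n, ContDiffBump (a n) := fun n => ⟨1, 2, one_pos, one_lt_two⟩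
  refine mem_closure_of_tendsto (b := Filter.atTop) (f := fun n => implant H (a n) (χ n)) ?_
    (Filter.Eventually.of_forall fun n => ⟨a n, ?_⟩)
  · refine SmoothFn.tendsto_of_eventually_eq fun C hC => ?_
    obtain ⟨R, hR⟩ := hC.isBounded.subset_ball 0
    -- The cutoff has outer radius `2`, so beyond `R + 2` its support misses the ball of radius `R`.
    obtain ⟨N, hN⟩ := exists_nat_gt (R + 2)
    filter_upwards [Filter.eventually_ge_atTop N] with n hn z hz
    have hfar : ∀ y ∈ Metric.ball (0 : Q × ℝ) R, 2 ≤ dist y (a n) := by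
      intro y hy
      have h1 : dist (0 : Q × ℝ) (a n) = n := by
        rw [dist_comm, dist_zero_right]
        simp [a, Prod.norm_def]
      have h2 := dist_triangle (0 : Q × ℝ) y (a n)
      have h3 : dist (0 : Q × ℝ) y < R := by rwa [dist_comm]
      have h4 : (N : ℝ) ≤ n := by exact_mod_cast hn
      linarith
    filter_upwards [Metric.isOpen_ball.mem_nhds (hR hz)] with y hy
    have : χ n y = 0 := (χ n).zero_of_le_dist (hfar y hy)
    simp [implant, this]
  · have hev : (implant H (a n) (χ n)).toFun =ᶠ[𝓝 (a n)] (model (a n)).toFun := by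
      filter_upwards [(χ n).eventuallyEq_one] with y hy
      have : χ n y = 1 := hy
      simp [implant, this]
    refine ⟨((parabolicMap_congr hev stdDir).eq_of_nhds).trans (parabolicMap_model _), ?_⟩
    rw [parabolicFDeriv_congr hev]
    exact injective_parabolicFDeriv_model _

/-- An open set of unperturbed families with nondegenerate parabolic circles, enlarged by the
perturbing terms, meets the generic set in a set of families with transverse resonances which is
dense in it. -/
theorem subset_closure_transverseResonance {V : Set (Q × ℝ)} (hV : IsOpen V) :
    {K : Family | ∃ z ∈ V, parabolicMap stdDir K.1 z = 0 ∧
      Function.Injective (parabolicFDeriv stdDir K.1 z)} ⊆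
    closure {K : Family | ∃ z ∈ V, K.HasTransverseResonance z} := by
  have hopen : IsOpen {K : Family | ∃ z ∈ V, parabolicMap stdDir K.1 z = 0 ∧
      Function.Injective (parabolicFDeriv stdDir K.1 z)} :=
    (isOpen_exists_nondegenerate hV).preimage continuous_fst
  refine (dense_all_transverse.open_subset_closure_inter hopen).trans (closure_mono ?_)
  rintro K ⟨⟨z, hzV, hz, -⟩, hK⟩
  exact ⟨z, hzV, hK z ((hasParabolicCircle_iff K z).2 hz)⟩

theorem nonempty_transverseResonance {V : Set (Q × ℝ)} (hV : IsOpen V) (hne : V.Nonempty) :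
    {K : Family | ∃ z ∈ V, K.HasTransverseResonance z}.Nonempty := by
  obtain ⟨a, ha⟩ := hne
  -- The zero perturbing term leaves the circle unperturbed, so this family is only in the closure;
  -- that already shows that the set is not empty.
  let P : Perturbation := ⟨⟨fun _ => 0, contDiff_const⟩, fun _ _ _ => rfl⟩
  have hmem := subset_closure_transverseResonance hV
    (show ((model a, P) : Family) ∈ _ from
      ⟨a, ha, parabolicMap_model a, injective_parabolicFDeriv_model a⟩)
  exact closure_nonempty_iff.1 ⟨_, hmem⟩

theorem dense_transverseResonance : Dense {K : Family | ∃ z, K.HasTransverseResonance z} := by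
  have h1 : Dense {K : Family | ∃ z ∈ Set.univ, parabolicMap stdDir K.1 z = 0 ∧
      Function.Injective (parabolicFDeriv stdDir K.1 z)} := by
    simp only [Set.mem_univ, true_and]
    exact dense_exists_nondegenerate.preimage isOpenMap_fst
  have h2 := h1.mono (subset_closure_transverseResonance isOpen_univ)
  simpa using dense_closure.1 h2

end Model

end ParabolicResonance

end

open ParabolicResonance
theorem corollary4 :
    -- occurrence of a (transverse) parabolic resonance is an open and dense property
    -- of one-parameter families, and it occurs robustly in every region
    (IsOpen {K : Family | ∃ z, K.HasTransverseResonance z} ∧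
      Dense {K : Family | ∃ z, K.HasTransverseResonance z} ∧
      ∀ V : Set (Q × ℝ), IsOpen V → V.Nonempty →
        IsOpen {K : Family | ∃ z ∈ V, K.HasTransverseResonance z} ∧
        {K : Family | ∃ z ∈ V, K.HasTransverseResonance z}.Nonempty) ∧
    -- in a generic family every parabolic circle of fixed points is a transverse parabolic
    -- resonance, and they are isolated (without accumulation)
    IsGeneric {K : Family |
      (∀ z, K.HasParabolicCircle z → K.HasTransverseResonance z) ∧
      ∀ C : Set (Q × ℝ), IsCompact C → {z ∈ C | K.HasParabolicCircle z}.Finite} ∧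
    -- each transverse parabolic resonance is isolated and persists in all nearby families
    (∀ (K : Family) (z : Q × ℝ), K.HasTransverseResonance z → ∀ V ∈ 𝓝 z,
      ∃ W ∈ 𝓝 z, W ⊆ V ∧ ∀ᶠ K' in 𝓝 K, ∃ z' ∈ W,
        K'.HasTransverseResonance z' ∧ ∀ y ∈ W, K'.HasParabolicCircle y → y = z') ∧
    -- a generic single Hamiltonian (no parameter) has no parabolic circle of fixed points
    IsGeneric {h : SmoothFn Q | ∀ q : Q, ¬ IsParabolicCircle h q} := by
  refine ⟨⟨?_, dense_transverseResonance, fun V hV hne =>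
    ⟨isOpen_exists_transverseResonance hV, nonempty_transverseResonance hV hne⟩⟩, ?_,
    transverseResonance_persists, isGeneric_no_parabolicCircle⟩
  · simpa using isOpen_exists_transverseResonance isOpen_univ
  · have hsub : {K : Family | ∀ z, K.HasParabolicCircle z → K.HasTransverseResonance z} ⊆
        {K : Family | (∀ z, K.HasParabolicCircle z → K.HasTransverseResonance z) ∧
          ∀ C : Set (Q × ℝ), IsCompact C → {z ∈ C | K.HasParabolicCircle z}.Finite} :=
      fun K hK => ⟨hK, fun C hC => finite_parabolicCircles hK hC⟩
    exact ⟨Filter.mem_of_superset isGeneric_all_transverse.1 hsub,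
      isGeneric_all_transverse.2.mono hsub⟩
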